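/- Let $d\ge 2$ be an integer and $S^1=\mathbb R/\mathbb Z$. For each $\delta\in(0,\frac14)$ let $U_\delta:\mathbb R\to\mathbb R$ be a $C^1$ bump function with $U_\delta(x)=1$ for $|x|\le\frac\delta2$, $U_\delta(x)=0$ for $|x|\ge\delta$, $U_\delta'\ge 0$ on $[-\delta,-\frac\delta2]$ and $U_\delta'\le 0$ on $[\frac\delta2,\delta]$. For $\varepsilon\in(0,1)$ and $\delta\in(0,\frac14)$ define $f_{\varepsilon,\delta}:S^1\to S^1$, in the coordinate $x\in[-\frac12,\frac12)$, by $$f_{\varepsilon,\delta}(x)=dx+(-d+\varepsilon)\,x\,U_\delta(x)\ \bmod 1,$$ and let $f_{0,0}(x)=E_d(x)=dx \bmod 1$. A point $x$ is non-wandering for $f$ if for every neighbourhood $V$ of $x$ there is $m\ge1$ with $f^m(V)\cap V\neq\emptyset$; $NW(f)$ is the set of such points. A $C^1$ map $f:S^1\to S^1$ is structurally stable if every $C^1$ map sufficiently $C^1$-close to $f$ is topologically conjugate to $f$. A nonsingular $d$-endomorphism is a $C^1$ map of $S^1$ onto itself of degree $d$ that has nowhere vanishing derivative and is a $d$-fold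 covering. 1. For all $\varepsilon\in(0,1)$, $\delta\in(0,\frac14)$ the map $f_{\varepsilon,\delta}$ is a nonsingular $d$-endomorphism. If moreover $U_\delta'(x)\neq0$ at every $x$ with $U_\delta(x)=\frac{d-1}{d-\varepsilon}$ (for instance, if $U_\delta'\ne0$ on $(-\delta,-\frac\delta2)\cup(\frac\delta2,\delta)$), then $f_{\varepsilon,\delta}$ is structurally stable, the point $0$ is a hyperbolic attracting fixed point of $f_{\varepsilon,\delta}$ and its only hyperbolic attracting periodic point, and $NW(f_{\varepsilon,\delta})=\{0\}\cup C$ for some Cantor set $C\subset S^1$ with $0\notin C$. 2. $f_{0,0}=E_d$ is a structurally stable nonsingular $d$-endomorphism and $NW(f_{0,0})=S^1$. 3. For every fixed $\varepsilon\in(0,1)$, $f_{\varepsilon,\delta}\to E_d$ uniformly on $S^1$ (i.e. in the $C^0$ topology) as $\delta\to0^+$. -/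

import Mathlib

open Set Filter Topology

/-- `U` is a (`C¹`) bump function of size `δ`: it equals `1` on `[-δ/2, δ/2]`, vanishes for
`|x| ≥ δ`, is nondecreasing on `[-δ, -δ/2]` and nonincreasing on `[δ/2, δ]`. -/
structure IsBump (δ : ℝ) (U : ℝ → ℝ) : Prop where
  contDiff : ContDiff ℝ 1 U
  eq_one : ∀ x ∈ Icc (-(δ / 2)) (δ / 2), U x = 1
  eq_zero : ∀ x, δ ≤ |x| → U x = 0
  deriv_nonneg : ∀ x ∈ Icc (-δ) (-(δ / 2)), 0 ≤ deriv U x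
  deriv_nonpos : ∀ x ∈ Icc (δ / 2) δ, deriv U x ≤ 0

/-- The linear expanding map `x ↦ d x mod 1` of the circle `ℝ / ℤ`. -/
def linearExpanding (d : ℕ) (x : UnitAddCircle) : UnitAddCircle := d • x

/-- The two-parameter family: `x ↦ d x + (-d + ε) x U_δ(x) mod 1`, where `x ∈ [-1/2, 1/2)` is the
coordinate on the circle, and `x ↦ d x mod 1` for `ε = δ = 0`. -/
noncomputable def bifFamily (d : ℕ) (U : ℝ → ℝ → ℝ) (ε δ : ℝ) : UnitAddCircle → UnitAddCircle :=
  open Classical in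
  if ε = 0 ∧ δ = 0 then linearExpanding d
  else AddCircle.liftIco (1 : ℝ) (-(1 / 2) : ℝ)
    (fun x : ℝ => ((d * x + (-d + ε) * x * U δ x : ℝ) : UnitAddCircle))

/-- `F : ℝ → ℝ` is a `C¹` lift of the circle map `f`. A circle map is `C¹` iff it has a `C¹` lift,
and two lifts differ by an integer, so that `F'` is the derivative of `f`. -/
def IsC1Lift (F : ℝ → ℝ) (f : UnitAddCircle → UnitAddCircle) : Prop :=
  ContDiff ℝ 1 F ∧ ∀ t : ℝ, f (t : UnitAddCircle) = (F t : UnitAddCircle)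

/-- `f` is a nonsingular `d`-endomorphism of the circle: a `C¹` map of the circle onto itself, of
degree `d`, whose derivative vanishes nowhere, and which is a `d`-fold covering. -/
def IsNonsingularEndo (d : ℕ) (f : UnitAddCircle → UnitAddCircle) : Prop :=
  (∃ F : ℝ → ℝ, IsC1Lift F f ∧ (∀ t, F (t + 1) = F t + d) ∧ ∀ t, deriv F t ≠ 0) ∧
  Function.Surjective f ∧ IsCoveringMap f ∧ ∀ y, (f ⁻¹' {y}).ncard = d

/-- `f` and `g` are `C¹` and at `C¹` distance less than `η`. -/
def C1Close (η : ℝ) (f g : UnitAddCircle → UnitAddCircle) : Prop :=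
  ∃ F G : ℝ → ℝ, IsC1Lift F f ∧ IsC1Lift G g ∧
    ∀ t, |F t - G t| < η ∧ |deriv F t - deriv G t| < η

/-- `f` is structurally stable: every `C¹` map that is sufficiently close to `f` in the `C¹`
topology is topologically conjugate to `f`. -/
def IsStructurallyStable (f : UnitAddCircle → UnitAddCircle) : Prop :=
  (∃ F, IsC1Lift F f) ∧
  ∃ η > 0, ∀ g : UnitAddCircle → UnitAddCircle, C1Close η f g →
    ∃ h : UnitAddCircle ≃ₜ UnitAddCircle, Function.Semiconj h f g

/-- The non-wandering set of `f`. -/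
def nonWandering {X : Type*} [TopologicalSpace X] (f : X → X) : Set X :=
  {x | ∀ V ∈ 𝓝 x, ∃ m : ℕ, 1 ≤ m ∧ ((f^[m]) '' V ∩ V).Nonempty}

/-- `x` is a hyperbolic attracting periodic point of `f`, of (not necessarily least) period `n`:
`fⁿ(x) = x` and `|(fⁿ)'(x)| < 1`. -/
def IsHyperbolicAttracting (f : UnitAddCircle → UnitAddCircle) (n : ℕ) (x : UnitAddCircle) : Prop :=
  0 < n ∧ f^[n] x = x ∧
    ∃ (F : ℝ → ℝ) (t : ℝ), IsC1Lift F f ∧ (t : UnitAddCircle) = x ∧ |deriv (F^[n]) t| < 1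

/-- A Cantor subset of the circle: nonempty, closed (hence compact), without isolated points,
and totally disconnected. -/
def IsCantor (C : Set UnitAddCircle) : Prop :=
  C.Nonempty ∧ Perfect C ∧ IsTotallyDisconnected C

/-!
Circle maps are studied through their lifts to `ℝ`. If `F` and `G` are increasing lifts of the same
degree and `Φ` is a homeomorphism commuting with the unit translation, then `G⁻ⁿ ∘ Φ ∘ Fⁿ`
converges uniformly to a conjugacy as soon as `F` and `G` are expanding. When `0` is attracting,
expansion is only available off the gap `(p, r)` between the two repelling fixed points adjacent to
`0`. On the gap `Φ` is therefore chosen to be a genuine conjugacy, built from fundamental domains of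
the two half-gaps, so that the error to be contracted lives only where `F` and `G` expand. Being
expanding off such a gap is a `C¹`-open condition, which gives structural stability.

The points whose orbit never enters the gap form a Cantor set: short arcs around them are
stretched until they cover the circle, which makes these points non-wandering and never attracting.
Every other orbit falls into the gap, where it moves monotonically towards `0`.
-/

/-! ### Lifts of circle maps -/

lemma map_add_intCast {F : ℝ → ℝ} {c : ℝ} (hF : ∀ x, F (x + 1) = F x + c) (x : ℝ) (k : ℤ) :
    F (x + k) = F x + c * k := by
  simpa [mul_comm] using AddConstMapClass.map_add_int' (⟨F, hF⟩ : AddConstMap ℝ ℝ 1 c) x k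

lemma iterate_map_add_intCast {F : ℝ → ℝ} {d : ℕ} (hF : ∀ x, F (x + 1) = F x + d) (n : ℕ) (x : ℝ)
    (k : ℤ) : F^[n] (x + k) = F^[n] x + (d : ℝ) ^ n * k := by
  induction n generalizing x k with
  | zero => simp
  | succ n ih =>
    have := ih (F x) (d * k)
    push_cast at this
    rw [Function.iterate_succ_apply, map_add_intCast hF, Function.iterate_succ_apply, this]
    ring

lemma iterate_coe {F : ℝ → ℝ} {f : UnitAddCircle → UnitAddCircle}
    (hf : ∀ t : ℝ, f t = (F t : UnitAddCircle)) (n : ℕ) (t : ℝ) :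
    f^[n] t = (F^[n] t : UnitAddCircle) :=
  have hsemi : Function.Semiconj (fun t : ℝ => (t : UnitAddCircle)) F f := fun t => (hf t).symm
  (hsemi.iterate_right n t).symm

lemma coe_eq_coe_iff_exists_int {s t : ℝ} :
    (s : UnitAddCircle) = t ↔ ∃ k : ℤ, t = s + k := by
  rw [eq_comm, ← sub_eq_zero, ← AddCircle.coe_sub, AddCircle.coe_eq_zero_iff]
  refine exists_congr fun k => ?_
  rw [zsmul_one, eq_comm, sub_eq_iff_eq_add']

lemma coe_add_int (t : ℝ) (k : ℤ) : ((t + k : ℝ) : UnitAddCircle) = t :=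
  (coe_eq_coe_iff_exists_int.2 ⟨k, rfl⟩).symm

lemma exists_int_eq_add_of_lifts {F G : ℝ → ℝ} (hF : Continuous F) (hG : Continuous G)
    (h : ∀ t, (F t : UnitAddCircle) = G t) : ∃ k : ℤ, ∀ t, G t = F t + k := by
  choose k hk using fun t => coe_eq_coe_iff_exists_int.1 (h t)
  have hkc : Continuous k := by
    refine Int.isClosedEmbedding_coe_real.isEmbedding.continuous_iff.2 ?_
    exact (hG.sub hF).congr fun t => sub_eq_iff_eq_add'.2 (hk t)
  refine ⟨k 0, fun t => ?_⟩
  rw [hk t, PreconnectedSpace.constant inferInstance hkc (x := t) (y := 0)]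

lemma surjective_of_degree {F : ℝ → ℝ} {d : ℕ} (hd : 0 < d) (hc : Continuous F)
    (hF : ∀ x, F (x + 1) = F x + d) : Function.Surjective F := by
  intro y
  obtain ⟨n, hn⟩ := exists_nat_ge |y - F 0|
  obtain ⟨hlow, hupp⟩ := abs_le.1 hn
  have hnd : (n : ℝ) ≤ d * n := le_mul_of_one_le_left n.cast_nonneg (by exact_mod_cast hd)
  have hright := map_add_intCast hF 0 n
  have hleft := map_add_intCast hF 0 (-n)
  push_cast at hright hleft
  exact mem_range_of_exists_le_of_exists_ge hc
    ⟨_, by rw [hleft]; linarith⟩ ⟨_, by rw [hright]; linarith⟩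

lemma exists_orderIso_of_degree {F : ℝ → ℝ} {d : ℕ} (hd : 0 < d) (hmono : StrictMono F)
    (hc : Continuous F) (hF : ∀ x, F (x + 1) = F x + d) : ∃ Φ : ℝ ≃o ℝ, ⇑Φ = F :=
  ⟨hmono.orderIsoOfSurjective F (surjective_of_degree hd hc hF), rfl⟩

lemma symm_map_add_one {Φ : ℝ ≃ ℝ} (hΦ : ∀ x, Φ (x + 1) = Φ x + 1) (x : ℝ) :
    Φ.symm (x + 1) = Φ.symm x + 1 := by
  rw [Equiv.symm_apply_eq, hΦ, Equiv.apply_symm_apply]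

lemma exists_continuous_circle_map {Φ : ℝ → ℝ} (hc : Continuous Φ)
    (hΦ : ∀ x, Φ (x + 1) = Φ x + 1) :
    ∃ h : UnitAddCircle → UnitAddCircle, Continuous h ∧ ∀ t : ℝ, h t = (Φ t : UnitAddCircle) := by
  have hper : Function.Periodic (fun t => (Φ t : UnitAddCircle)) 1 := fun t => by
    simp only [hΦ, AddCircle.coe_add, AddCircle.coe_period, add_zero]
  exact ⟨hper.lift, continuous_quot_lift _ ((AddCircle.continuous_mk' 1).comp hc), fun _ => rfl⟩

lemma exists_circle_homeomorph (Φ : ℝ ≃ₜ ℝ) (hΦ : ∀ x, Φ (x + 1) = Φ x + 1) :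
    ∃ h : UnitAddCircle ≃ₜ UnitAddCircle, ∀ t : ℝ, h t = (Φ t : UnitAddCircle) := by
  obtain ⟨h, hc, hh⟩ := exists_continuous_circle_map Φ.continuous hΦ
  obtain ⟨h', hc', hh'⟩ :=
    exists_continuous_circle_map Φ.symm.continuous (symm_map_add_one (Φ := Φ.toEquiv) hΦ)
  refine ⟨⟨⟨h, h', fun x => ?_, fun x => ?_⟩, hc, hc'⟩, hh⟩
  · induction x using QuotientAddGroup.induction_on with | H t => ?_
    rw [hh, hh', Φ.symm_apply_apply]
  · induction x using QuotientAddGroup.induction_on with | H t => ?_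
    rw [hh', hh, Φ.apply_symm_apply]

/-- `F` and `G` are conjugate by a homeomorphism of the line that commutes with the unit
translation, so that the circle maps they lift are topologically conjugate. -/
def LiftConj (F G : ℝ → ℝ) : Prop :=
  ∃ Ψ : ℝ ≃ₜ ℝ, (∀ x, Ψ (x + 1) = Ψ x + 1) ∧ Function.Semiconj Ψ F G

lemma LiftConj.exists_homeomorph_semiconj {F G : ℝ → ℝ} {f g : UnitAddCircle → UnitAddCircle}
    (h : LiftConj F G) (hf : ∀ t : ℝ, f t = (F t : UnitAddCircle))
    (hg : ∀ t : ℝ, g t = (G t : UnitAddCircle)) :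
    ∃ h : UnitAddCircle ≃ₜ UnitAddCircle, Function.Semiconj h f g := by
  obtain ⟨Ψ, hΨ, hconj⟩ := h
  obtain ⟨h, hh⟩ := exists_circle_homeomorph Ψ hΨ
  refine ⟨h, fun x => ?_⟩
  induction x using QuotientAddGroup.induction_on with | H t => ?_
  rw [hf, hh, hh, hg, hconj]

/-! ### Conjugacies as limits -/

lemma exists_tendstoUniformly_of_dist_le_geometric {X Y : Type*} [PseudoMetricSpace Y]
    [CompleteSpace Y] {H : ℕ → X → Y} {K ρ : ℝ} (hρ0 : 0 ≤ ρ) (hρ1 : ρ < 1)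
    (h : ∀ x n, dist (H n x) (H (n + 1) x) ≤ K * ρ ^ n) :
    ∃ Ψ, TendstoUniformly H Ψ atTop := by
  choose Ψ hΨ using fun x =>
    cauchySeq_tendsto_of_complete (cauchySeq_of_le_geometric ρ K hρ1 (h x))
  refine ⟨Ψ, Metric.tendstoUniformly_iff.2 fun e he => ?_⟩
  have hlim : Tendsto (fun n : ℕ => K * ρ ^ n / (1 - ρ)) atTop (𝓝 0) := by
    simpa using ((tendsto_pow_atTop_nhds_zero_of_lt_one hρ0 hρ1).const_mul K).div_const (1 - ρ)
  filter_upwards [hlim.eventually (gt_mem_nhds he)] with n hn x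
  rw [dist_comm]
  exact (dist_le_of_le_geometric_of_tendsto ρ K hρ1 (h x) (hΨ x) n).trans_lt hn

section ApproxConj

/-- The approximate conjugacies `G⁻ⁿ ∘ Φ ∘ Fⁿ`, whose limit conjugates `F` to `G`. -/
def approxConj {X Y : Type*} [TopologicalSpace X] [TopologicalSpace Y] (F : X ≃ₜ X) (G : Y ≃ₜ Y)
    (Φ : X ≃ₜ Y) : ℕ → X ≃ₜ Y
  | 0 => Φ
  | n + 1 => (F.trans (approxConj F G Φ n)).trans G.symm

lemma approxConj_succ {X Y : Type*} [TopologicalSpace X] [TopologicalSpace Y] (F : X ≃ₜ X)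
    (G : Y ≃ₜ Y) (Φ : X ≃ₜ Y) (n : ℕ) (x : X) :
    approxConj F G Φ (n + 1) x = G.symm (approxConj F G Φ n (F x)) := rfl

lemma map_approxConj_succ {X Y : Type*} [TopologicalSpace X] [TopologicalSpace Y] (F : X ≃ₜ X)
    (G : Y ≃ₜ Y) (Φ : X ≃ₜ Y) (n : ℕ) (x : X) :
    G (approxConj F G Φ (n + 1) x) = approxConj F G Φ n (F x) := by
  rw [approxConj_succ, G.apply_symm_apply]

lemma approxConj_symm {X Y : Type*} [TopologicalSpace X] [TopologicalSpace Y] (F : X ≃ₜ X)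
    (G : Y ≃ₜ Y) (Φ : X ≃ₜ Y) (n : ℕ) :
    approxConj G F Φ.symm n = (approxConj F G Φ n).symm := by
  induction n with
  | zero => rfl
  | succ n ih =>
    ext x
    rw [approxConj_succ, ih, eq_comm, Homeomorph.symm_apply_eq, approxConj_succ,
      Homeomorph.apply_symm_apply, Homeomorph.apply_symm_apply, Homeomorph.symm_apply_apply]

variable {X Y : Type*} [MetricSpace X] [MetricSpace Y] {F : X ≃ₜ X} {G : Y ≃ₜ Y} {Φ : X ≃ₜ Y}

lemma dist_approxConj_le {κ K : ℝ} (hκ : 0 < κ) (hK : ∀ x, dist (Φ x) (approxConj F G Φ 1 x) ≤ K)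
    (hexp : ∀ n x, κ * dist (approxConj F G Φ n x) (approxConj F G Φ (n + 1) x) ≤
      dist (G (approxConj F G Φ n x)) (G (approxConj F G Φ (n + 1) x))) (x : X) (n : ℕ) :
    dist (approxConj F G Φ n x) (approxConj F G Φ (n + 1) x) ≤ K * κ⁻¹ ^ n := by
  induction n generalizing x with
  | zero => rw [pow_zero, mul_one]; exact hK x
  | succ n ih =>
    rw [pow_succ, ← mul_assoc, ← div_eq_mul_inv, le_div_iff₀' hκ]
    calc _ ≤ _ := hexp (n + 1) x
      _ = dist (approxConj F G Φ n (F x)) (approxConj F G Φ (n + 1) (F x)) := by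
        rw [map_approxConj_succ, map_approxConj_succ]
      _ ≤ _ := ih (F x)

lemma leftInverse_of_tendstoUniformly_approxConj {Ψ : X → Y} {Ψ' : Y → X}
    (h : TendstoUniformly (fun n x => approxConj F G Φ n x) Ψ atTop)
    (h' : TendstoUniformly (fun n y => approxConj G F Φ.symm n y) Ψ' atTop) :
    Function.LeftInverse Ψ' Ψ := by
  intro x
  have hc : Continuous Ψ' :=
    h'.continuous (Frequently.of_forall fun n => (approxConj G F Φ.symm n).continuous)
  have hlim := h'.tendsto_comp hc.continuousAt (h.tendsto_at x)
  simp only [approxConj_symm, Homeomorph.symm_apply_apply] at hlim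
  exact tendsto_nhds_unique hlim tendsto_const_nhds

lemma exists_conj_of_approxConj [CompleteSpace X] [CompleteSpace Y] {κ κ' K K' : ℝ} (hκ : 1 < κ)
    (hκ' : 1 < κ') (hK : ∀ x, dist (Φ x) (approxConj F G Φ 1 x) ≤ K)
    (hK' : ∀ y, dist (Φ.symm y) (approxConj G F Φ.symm 1 y) ≤ K')
    (hexp : ∀ n x, κ * dist (approxConj F G Φ n x) (approxConj F G Φ (n + 1) x) ≤
      dist (G (approxConj F G Φ n x)) (G (approxConj F G Φ (n + 1) x)))
    (hexp' : ∀ n y, κ' * dist (approxConj G F Φ.symm n y) (approxConj G F Φ.symm (n + 1) y) ≤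
      dist (F (approxConj G F Φ.symm n y)) (F (approxConj G F Φ.symm (n + 1) y))) :
    ∃ Ψ : X ≃ₜ Y, (∀ x, Tendsto (fun n => approxConj F G Φ n x) atTop (𝓝 (Ψ x))) ∧
      Function.Semiconj Ψ F G := by
  have hκ0 : 0 < κ := zero_lt_one.trans hκ
  have hκ0' : 0 < κ' := zero_lt_one.trans hκ'
  obtain ⟨Ψ, hΨ⟩ := exists_tendstoUniformly_of_dist_le_geometric (inv_nonneg.2 hκ0.le)
    (inv_lt_one_of_one_lt₀ hκ) (dist_approxConj_le hκ0 hK hexp)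
  obtain ⟨Ψ', hΨ'⟩ := exists_tendstoUniformly_of_dist_le_geometric (inv_nonneg.2 hκ0'.le)
    (inv_lt_one_of_one_lt₀ hκ') (dist_approxConj_le hκ0' hK' hexp')
  have hc : Continuous Ψ :=
    hΨ.continuous (Frequently.of_forall fun n => (approxConj F G Φ n).continuous)
  have hc' : Continuous Ψ' :=
    hΨ'.continuous (Frequently.of_forall fun n => (approxConj G F Φ.symm n).continuous)
  refine ⟨⟨⟨Ψ, Ψ', leftInverse_of_tendstoUniformly_approxConj hΨ hΨ',
    leftInverse_of_tendstoUniformly_approxConj hΨ' hΨ⟩, hc, hc'⟩, hΨ.tendsto_at, fun x => ?_⟩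
  have hlim := (G.continuous.tendsto _).comp ((tendsto_add_atTop_iff_nat 1).2 (hΨ.tendsto_at x))
  exact tendsto_nhds_unique (hΨ.tendsto_at (F x))
    (hlim.congr fun n => map_approxConj_succ F G Φ n x)

end ApproxConj

section ApproxConjReal

variable {F G Φ : ℝ ≃ₜ ℝ}

lemma approxConj_add_one {d : ℕ} (hF : ∀ x, F (x + 1) = F x + d)
    (hG : ∀ x, G (x + 1) = G x + d) (hΦ : ∀ x, Φ (x + 1) = Φ x + 1) (n : ℕ) (x : ℝ) :
    approxConj F G Φ n (x + 1) = approxConj F G Φ n x + 1 := by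
  induction n generalizing x with
  | zero => exact hΦ x
  | succ n ih =>
    apply G.injective
    rw [map_approxConj_succ, hF, hG, map_approxConj_succ]
    simpa using map_add_intCast ih (F x) d

lemma monotone_approxConj (hF : Monotone F) (hG : StrictMono G) (hΦ : Monotone Φ) (n : ℕ) :
    Monotone (approxConj F G Φ n) := by
  induction n with
  | zero => exact hΦ
  | succ n ih =>
    intro x y hxy
    rw [← hG.le_iff_le, map_approxConj_succ, map_approxConj_succ]
    exact ih (hF hxy)

lemma exists_dist_le_of_map_add_one {Φ Θ : ℝ → ℝ} (hΦc : Continuous Φ) (hΘc : Continuous Θ)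
    (hΦ : ∀ x, Φ (x + 1) = Φ x + 1) (hΘ : ∀ x, Θ (x + 1) = Θ x + 1) :
    ∃ K, ∀ x, dist (Φ x) (Θ x) ≤ K := by
  have hper : Function.Periodic (fun x => Φ x - Θ x) 1 := fun x => by
    simp only [hΦ, hΘ, add_sub_add_right_eq_sub]
  obtain ⟨K, hK⟩ := (hper.isBounded_of_continuous one_ne_zero (hΦc.sub hΘc)).exists_norm_le
  exact ⟨K, fun x => by simpa only [dist_eq_norm] using hK _ (mem_range_self x)⟩

lemma liftConj_of_approxConj {d : ℕ} (hF : ∀ x, F (x + 1) = F x + d)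
    (hG : ∀ x, G (x + 1) = G x + d) (hΦ : ∀ x, Φ (x + 1) = Φ x + 1) {κ κ' : ℝ} (hκ : 1 < κ)
    (hκ' : 1 < κ')
    (hexp : ∀ n x, κ * dist (approxConj F G Φ n x) (approxConj F G Φ (n + 1) x) ≤
      dist (G (approxConj F G Φ n x)) (G (approxConj F G Φ (n + 1) x)))
    (hexp' : ∀ n x, κ' * dist (approxConj G F Φ.symm n x) (approxConj G F Φ.symm (n + 1) x) ≤
      dist (F (approxConj G F Φ.symm n x)) (F (approxConj G F Φ.symm (n + 1) x))) :
    LiftConj F G := by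
  have hΦ' : ∀ x, Φ.symm (x + 1) = Φ.symm x + 1 := symm_map_add_one (Φ := Φ.toEquiv) hΦ
  obtain ⟨K, hK⟩ := exists_dist_le_of_map_add_one Φ.continuous (approxConj F G Φ 1).continuous
    hΦ (approxConj_add_one hF hG hΦ 1)
  obtain ⟨K', hK'⟩ := exists_dist_le_of_map_add_one Φ.symm.continuous
    (approxConj G F Φ.symm 1).continuous hΦ' (approxConj_add_one hG hF hΦ' 1)
  obtain ⟨Ψ, hlim, hconj⟩ := exists_conj_of_approxConj hκ hκ' hK hK' hexp hexp'
  refine ⟨Ψ, fun x => tendsto_nhds_unique (hlim (x + 1)) ?_, hconj⟩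
  simpa only [approxConj_add_one hF hG hΦ] using (hlim x).add_const 1

lemma liftConj_of_expanding {d : ℕ} (hF : ∀ x, F (x + 1) = F x + d)
    (hG : ∀ x, G (x + 1) = G x + d) {κ κ' : ℝ} (hκ : 1 < κ) (hκ' : 1 < κ')
    (hFe : ∀ x y, κ * dist x y ≤ dist (F x) (F y))
    (hGe : ∀ x y, κ' * dist x y ≤ dist (G x) (G y)) : LiftConj F G :=
  liftConj_of_approxConj (Φ := Homeomorph.refl ℝ) hF hG (fun _ => rfl) hκ' hκ
    (fun _ _ => hGe _ _) (fun _ _ => hFe _ _)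

end ApproxConjReal

/-! ### Fundamental domains of increasing maps -/

section FundamentalDomain

lemma zpow_add_one_apply {α : Type*} [LE α] (F : α ≃o α) (n : ℤ) (x : α) :
    (F ^ (n + 1)) x = F ((F ^ n) x) := by
  rw [add_comm, zpow_one_add]; rfl

lemma zpow_add_one_apply' {α : Type*} [LE α] (F : α ≃o α) (n : ℤ) (x : α) :
    (F ^ (n + 1)) x = (F ^ n) (F x) := by
  rw [zpow_add_one]; rfl

lemma zpow_apply_eq_self {α : Type*} [LE α] {F : α ≃o α} {x : α} (hx : F x = x) (n : ℤ) :
    (F ^ n) x = x :=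
  (MulAction.stabilizer (α ≃o α) x).zpow_mem (MulAction.mem_stabilizer_iff.2 hx) n

lemma strictMono_zpow_apply {α : Type*} [Preorder α] {F : α ≃o α} {c : α} (hc : c < F c) :
    StrictMono fun n : ℤ => (F ^ n) c :=
  strictMono_int_of_lt_succ fun n => by
    rw [zpow_add_one_apply']; exact (F ^ n).strictMono hc

variable {α : Type*} [ConditionallyCompleteLinearOrder α] {F : α ≃o α} {c : α}

lemma map_ciSup_zpow (hbdd : BddAbove (range fun n : ℤ => (F ^ n) c)) :
    F (⨆ n : ℤ, (F ^ n) c) = ⨆ n : ℤ, (F ^ n) c := by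
  rw [F.map_ciSup hbdd]
  simp only [← zpow_add_one_apply]
  exact (Equiv.addRight (1 : ℤ)).iSup_comp (g := fun n : ℤ => (F ^ n) c)

lemma map_ciInf_zpow (hbdd : BddBelow (range fun n : ℤ => (F ^ n) c)) :
    F (⨅ n : ℤ, (F ^ n) c) = ⨅ n : ℤ, (F ^ n) c := by
  rw [F.map_ciInf hbdd]
  simp only [← zpow_add_one_apply]
  exact (Equiv.addRight (1 : ℤ)).iInf_comp (g := fun n : ℤ => (F ^ n) c)

-- The supremum and the infimum of an orbit are fixed points, so they cannot lie inside `(a, b)`.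
lemma iUnion_Ico_zpow_eq_Ioo {a b : α} (ha : F a = a) (hb : F b = b)
    (hF : ∀ x ∈ Ioo a b, x < F x) (hc : c ∈ Ioo a b) :
    ⋃ n : ℤ, Ico ((F ^ n) c) ((F ^ (n + 1)) c) = Ioo a b := by
  have hmono := strictMono_zpow_apply (hF c hc)
  have hmem : ∀ n : ℤ, (F ^ n) c ∈ Ioo a b := fun n =>
    ⟨zpow_apply_eq_self ha n ▸ (F ^ n).strictMono hc.1,
      zpow_apply_eq_self hb n ▸ (F ^ n).strictMono hc.2⟩
  have hbddAbove : BddAbove (range fun n : ℤ => (F ^ n) c) :=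
    ⟨b, forall_mem_range.2 fun n => (hmem n).2.le⟩
  have hbddBelow : BddBelow (range fun n : ℤ => (F ^ n) c) :=
    ⟨a, forall_mem_range.2 fun n => (hmem n).1.le⟩
  refine Subset.antisymm (iUnion_subset fun n x hx =>
    ⟨(hmem n).1.trans_le hx.1, hx.2.trans (hmem _).2⟩) fun x hx => mem_iUnion.2 ?_
  obtain ⟨m, hm⟩ : ∃ m : ℤ, x < (F ^ m) c := by
    by_contra! h
    have hsup : c ≤ ⨆ n : ℤ, (F ^ n) c := le_ciSup hbddAbove 0
    exact (hF _ ⟨hc.1.trans_le hsup, (ciSup_le h).trans_lt hx.2⟩).ne' (map_ciSup_zpow hbddAbove)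
  obtain ⟨l, hl⟩ : ∃ l : ℤ, (F ^ l) c ≤ x := by
    by_contra! h
    have hinf : (⨅ n : ℤ, (F ^ n) c) ≤ c := ciInf_le hbddBelow 0
    exact (hF _ ⟨hx.1.trans_le (le_ciInf fun n => (h n).le), hinf.trans_lt hc.2⟩).ne'
      (map_ciInf_zpow hbddBelow)
  obtain ⟨n, hn, hgreatest⟩ := Int.exists_greatest_of_bdd (P := fun n : ℤ => (F ^ n) c ≤ x)
    ⟨m, fun z hz => (hmono.lt_iff_lt.1 (hz.trans_lt hm)).le⟩ ⟨l, hl⟩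
  exact ⟨n, hn, lt_of_not_ge fun h => absurd (hgreatest _ h) (lt_add_one n).not_ge⟩

end FundamentalDomain

lemma exists_equivariant_extension {α : Type*} [Preorder α] {F : α ≃o α} {c : α} (hc : c < F c)
    {γ : ℝ → α} (hγ : StrictMonoOn γ (Ico 0 1)) (hγc : γ '' Ico 0 1 = Ico c (F c)) :
    ∃ β : ℝ → α, StrictMono β ∧ (∀ s, β (s + 1) = F (β s)) ∧
      range β = ⋃ n : ℤ, Ico ((F ^ n) c) ((F ^ (n + 1)) c) := by
  have hfract : ∀ s : ℝ, Int.fract s ∈ Ico (0 : ℝ) 1 := fun s =>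
    ⟨Int.fract_nonneg s, Int.fract_lt_one s⟩
  have hmem : ∀ s : ℝ,
      (F ^ ⌊s⌋) (γ (Int.fract s)) ∈ Ico ((F ^ ⌊s⌋) c) ((F ^ (⌊s⌋ + 1)) c) := fun s => by
    have hγs : γ (Int.fract s) ∈ Ico c (F c) := hγc ▸ mem_image_of_mem γ (hfract s)
    rw [zpow_add_one_apply']
    exact ⟨(F ^ ⌊s⌋).monotone hγs.1, (F ^ ⌊s⌋).strictMono hγs.2⟩
  refine ⟨fun s => (F ^ ⌊s⌋) (γ (Int.fract s)), fun s t hst => ?_, fun s => ?_,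
    Subset.antisymm (range_subset_iff.2 fun s => mem_iUnion.2 ⟨_, hmem s⟩)
      (iUnion_subset fun n x hx => ?_)⟩
  · rcases (Int.floor_mono hst.le).eq_or_lt with hfloor | hfloor
    · have : Int.fract s < Int.fract t := by
        rw [← Int.self_sub_floor, ← Int.self_sub_floor, hfloor]; linarith
      simp only [hfloor]
      exact (F ^ ⌊t⌋).strictMono (hγ (hfract s) (hfract t) this)
    · exact (hmem s).2.trans_le (((strictMono_zpow_apply hc).monotone
        (Int.add_one_le_iff.2 hfloor)).trans (hmem t).1)
  · simp only [Int.floor_add_one, Int.fract_add_one, zpow_add_one_apply]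
  · have hy : (F ^ n).symm x ∈ Ico c (F c) := by
      rw [zpow_add_one_apply'] at hx
      exact ⟨(OrderIso.le_symm_apply _).2 hx.1, (OrderIso.symm_apply_lt _).2 hx.2⟩
    obtain ⟨t, ht, hty⟩ := hγc.symm ▸ hy
    refine ⟨n + t, ?_⟩
    simp only [Int.floor_intCast_add, Int.fract_intCast_add, Int.floor_eq_zero_iff.2 ht,
      Int.fract_eq_self.2 ht, add_zero, hty, OrderIso.apply_symm_apply]

/-! ### Increasing bijections between intervals -/

/-- `ψ` restricts to an increasing bijection from `[a, b]` onto `[a', b']`. It is kept as a total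
function so that such bijections can be glued along their endpoints. -/
structure IsIncreasingBij {α β : Type*} [Preorder α] [Preorder β] (ψ : α → β) (a b : α)
    (a' b' : β) : Prop where
  strictMonoOn : StrictMonoOn ψ (Icc a b)
  left : ψ a = a'
  right : ψ b = b'
  surjOn : SurjOn ψ (Icc a b) (Icc a' b')

namespace IsIncreasingBij

variable {α β : Type*} [LinearOrder α] [LinearOrder β]

lemma image_Ico {ψ : α → β} {a b : α} {a' b' : β} (h : IsIncreasingBij ψ a b a' b') :
    ψ '' Ico a b = Ico a' b' := by
  ext y
  constructor
  · rintro ⟨x, hx, rfl⟩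
    have hab := hx.1.trans hx.2.le
    rw [← h.left, ← h.right]
    exact ⟨h.strictMonoOn.monotoneOn ⟨le_rfl, hab⟩ ⟨hx.1, hx.2.le⟩ hx.1,
      h.strictMonoOn ⟨hx.1, hx.2.le⟩ ⟨hab, le_rfl⟩ hx.2⟩
  · intro hy
    obtain ⟨x, hx, rfl⟩ := h.surjOn ⟨hy.1, hy.2.le⟩
    exact ⟨x, ⟨hx.1, hx.2.lt_of_ne fun hxb => hy.2.ne (hxb ▸ h.right)⟩, rfl⟩

lemma exists_glue {ψ₁ ψ₂ : α → β} {a b c : α} {a' b' c' : β} (h₁ : IsIncreasingBij ψ₁ a b a' b')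
    (h₂ : IsIncreasingBij ψ₂ b c b' c') (hab : a ≤ b) (hbc : b ≤ c) :
    ∃ ψ, IsIncreasingBij ψ a c a' c' ∧ EqOn ψ ψ₁ (Icc a b) ∧ EqOn ψ ψ₂ (Icc b c) := by
  set ψ : α → β := fun x => if x ≤ b then ψ₁ x else ψ₂ x
  have e₁ : EqOn ψ ψ₁ (Icc a b) := fun x hx => if_pos hx.2
  have e₂ : EqOn ψ ψ₂ (Icc b c) := fun x hx => by
    rcases hx.1.eq_or_lt with rfl | h
    · rw [e₁ ⟨hab, le_rfl⟩, h₁.right, h₂.left]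
    · exact if_neg h.not_ge
  refine ⟨ψ, ⟨?_, ?_, ?_, fun y hy => ?_⟩, e₁, e₂⟩
  · rw [← Icc_union_Icc_eq_Icc hab hbc]
    exact (h₁.strictMonoOn.congr e₁.symm).union (h₂.strictMonoOn.congr e₂.symm)
      (isGreatest_Icc hab) (isLeast_Icc hbc)
  · rw [e₁ ⟨le_rfl, hab⟩, h₁.left]
  · rw [e₂ ⟨hbc, le_rfl⟩, h₂.right]
  · rcases le_total y b' with h | h
    · obtain ⟨x, hx, rfl⟩ := h₁.surjOn ⟨hy.1, h⟩
      exact ⟨x, ⟨hx.1, hx.2.trans hbc⟩, e₁ hx⟩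
    · obtain ⟨x, hx, rfl⟩ := h₂.surjOn ⟨h, hy.2⟩
      exact ⟨x, ⟨hab.trans hx.1, hx.2⟩, e₂ hx⟩

end IsIncreasingBij

lemma exists_isIncreasingBij {a b a' b' : ℝ} (h : a < b) (h' : a' < b') :
    ∃ ψ, IsIncreasingBij ψ a b a' b' := by
  have hs : 0 < (b' - a') / (b - a) := div_pos (sub_pos.2 h') (sub_pos.2 h)
  have hright : a' + (b' - a') / (b - a) * (b - a) = b' := by
    rw [div_mul_cancel₀ _ (sub_pos.2 h).ne', add_sub_cancel]
  refine ⟨fun x => a' + (b' - a') / (b - a) * (x - a), fun x _ y _ hxy => ?_, by simp, hright, ?_⟩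
  · linarith [mul_lt_mul_of_pos_left (sub_lt_sub_right hxy a) hs]
  · have hc : ContinuousOn (fun x => a' + (b' - a') / (b - a) * (x - a)) (Icc a b) := by fun_prop
    have hsurj := intermediate_value_Icc h.le hc
    simp only [sub_self, mul_zero, add_zero, hright] at hsurj
    exact hsurj

lemma exists_isIncreasingBij_of_range_eq_Ioo {ι α β : Type*} [LinearOrder ι] [Nonempty ι]
    [LinearOrder α] [LinearOrder β] {a b : α} {a' b' : β} (hab : a < b)
    {φ : ι → α} {φ' : ι → β} (hφ : StrictMono φ) (hφ' : StrictMono φ') (hr : range φ = Ioo a b)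
    (hr' : range φ' = Ioo a' b') :
    ∃ ψ, IsIncreasingBij ψ a b a' b' ∧ ∀ s, ψ (φ s) = φ' s := by
  have hmem : ∀ s, φ s ∈ Ioo a b := fun s => hr ▸ mem_range_self s
  have hmem' : ∀ s, φ' s ∈ Ioo a' b' := fun s => hr' ▸ mem_range_self s
  set ψ : α → β := fun x => if x ≤ a then a' else if b ≤ x then b' else
    φ' (Function.invFun φ x) with hψ
  have hψa : ψ a = a' := if_pos le_rfl
  have hψb : ψ b = b' := by simp only [hψ, if_neg hab.not_ge, le_refl, if_true]
  have hψφ : ∀ s, ψ (φ s) = φ' s := fun s => by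
    simp only [hψ, if_neg (hmem s).1.not_ge, if_neg (hmem s).2.not_ge,
      Function.leftInverse_invFun hφ.injective s]
  have hsurj : SurjOn ψ (Icc a b) (Icc a' b') := by
    intro y hy
    rcases eq_endpoints_or_mem_Ioo_of_mem_Icc hy with rfl | rfl | hy
    · exact ⟨a, left_mem_Icc.2 hab.le, hψa⟩
    · exact ⟨b, right_mem_Icc.2 hab.le, hψb⟩
    · obtain ⟨s, rfl⟩ := hr' ▸ hy
      exact ⟨φ s, Ioo_subset_Icc_self (hmem s), hψφ s⟩
  have hmono : StrictMonoOn ψ (Icc a b) := by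
    intro x hx y hy hxy
    rcases eq_endpoints_or_mem_Ioo_of_mem_Icc hx with rfl | rfl | hx
    · rcases eq_endpoints_or_mem_Ioo_of_mem_Icc hy with rfl | rfl | hy
      · exact absurd hxy (lt_irrefl _)
      · rw [hψa, hψb]; exact (hmem' (Classical.arbitrary ι)).1.trans (hmem' _).2
      · obtain ⟨t, rfl⟩ := hr ▸ hy
        rw [hψa, hψφ]; exact (hmem' t).1
    · exact absurd hxy hy.2.not_gt
    · obtain ⟨s, rfl⟩ := hr ▸ hx
      rcases eq_endpoints_or_mem_Ioo_of_mem_Icc hy with rfl | rfl | hy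
      · exact absurd hxy hx.1.not_gt
      · rw [hψb, hψφ]; exact (hmem' s).2
      · obtain ⟨t, rfl⟩ := hr ▸ hy
        rw [hψφ, hψφ]; exact hφ' (hφ.lt_iff_lt.1 hxy)
  exact ⟨ψ, ⟨hmono, hψa, hψb, hsurj⟩, hψφ⟩

section Conjugacy

variable {F G : ℝ ≃o ℝ} {a b a' b' : ℝ}

lemma exists_translation_coordinate (hab : a < b) (ha : F a = a) (hb : F b = b)
    (hF : ∀ x ∈ Ioo a b, x < F x) :
    ∃ β : ℝ → ℝ, StrictMono β ∧ (∀ s, β (s + 1) = F (β s)) ∧ range β = Ioo a b := by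
  obtain ⟨c, hc⟩ := nonempty_Ioo.2 hab
  obtain ⟨γ, hγ⟩ := exists_isIncreasingBij zero_lt_one (hF c hc)
  rw [← iUnion_Ico_zpow_eq_Ioo ha hb hF hc]
  exact exists_equivariant_extension (hF c hc) (hγ.strictMonoOn.mono Ico_subset_Icc_self)
    hγ.image_Ico

lemma exists_isIncreasingBij_conj_of_lt_map (hab : a < b) (hab' : a' < b') (ha : F a = a)
    (hb : F b = b) (ha' : G a' = a') (hb' : G b' = b') (hF : ∀ x ∈ Ioo a b, x < F x)
    (hG : ∀ x ∈ Ioo a' b', x < G x) :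
    ∃ ψ, IsIncreasingBij ψ a b a' b' ∧ ∀ x ∈ Icc a b, ψ (F x) = G (ψ x) := by
  obtain ⟨β, hβ, hβF, hβr⟩ := exists_translation_coordinate hab ha hb hF
  obtain ⟨β', hβ', hβG, hβr'⟩ := exists_translation_coordinate hab' ha' hb' hG
  obtain ⟨ψ, hψ, hψβ⟩ := exists_isIncreasingBij_of_range_eq_Ioo hab hβ hβ' hβr hβr'
  refine ⟨ψ, hψ, fun x hx => ?_⟩
  rcases eq_endpoints_or_mem_Ioo_of_mem_Icc hx with rfl | rfl | hx
  · rw [ha, hψ.left, ha']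
  · rw [hb, hψ.right, hb']
  · obtain ⟨s, rfl⟩ := hβr ▸ hx
    rw [← hβF, hψβ, hψβ, hβG]

lemma exists_isIncreasingBij_conj_of_map_lt (hab : a < b) (hab' : a' < b') (ha : F a = a)
    (hb : F b = b) (ha' : G a' = a') (hb' : G b' = b') (hF : ∀ x ∈ Ioo a b, F x < x)
    (hG : ∀ x ∈ Ioo a' b', G x < x) :
    ∃ ψ, IsIncreasingBij ψ a b a' b' ∧ ∀ x ∈ Icc a b, ψ (F x) = G (ψ x) := by
  obtain ⟨ψ, hψ, hconj⟩ := exists_isIncreasingBij_conj_of_lt_map (F := F.symm) (G := G.symm)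
    hab hab' (F.symm_apply_eq.2 ha.symm) (F.symm_apply_eq.2 hb.symm)
    (G.symm_apply_eq.2 ha'.symm) (G.symm_apply_eq.2 hb'.symm)
    (fun x hx => F.lt_symm_apply.2 (hF x hx)) (fun x hx => G.lt_symm_apply.2 (hG x hx))
  refine ⟨ψ, hψ, fun x hx => ?_⟩
  have hFx : F x ∈ Icc a b := ⟨ha ▸ F.monotone hx.1, hb ▸ F.monotone hx.2⟩
  have h := hconj (F x) hFx
  rw [F.symm_apply_apply] at h
  rw [h, G.apply_symm_apply]

end Conjugacy

lemma IsIncreasingBij.exists_orderIso_eqOn {ψ : ℝ → ℝ} {p p' : ℝ}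
    (h : IsIncreasingBij ψ p (p + 1) p' (p' + 1)) :
    ∃ Φ : ℝ ≃o ℝ, (∀ x, Φ (x + 1) = Φ x + 1) ∧ EqOn Φ ψ (Icc p (p + 1)) := by
  set φ : ℝ → ℝ := fun x => ψ (p + Int.fract (x - p)) + ⌊x - p⌋ with hφ
  have hadd : ∀ x, φ (x + 1) = φ x + 1 := fun x => by
    simp only [hφ, add_sub_right_comm, Int.fract_add_one, Int.floor_add_one]
    push_cast
    ring
  have heq : EqOn φ ψ (Icc p (p + 1)) := by
    have hIco : EqOn φ ψ (Ico p (p + 1)) := fun x hx => by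
      have hx' : x - p ∈ Ico (0 : ℝ) 1 := ⟨by linarith [hx.1], by linarith [hx.2]⟩
      simp only [hφ, Int.fract_eq_self.2 hx', Int.floor_eq_zero_iff.2 hx', add_sub_cancel,
        Int.cast_zero, add_zero]
    intro x hx
    rcases hx.2.eq_or_lt with rfl | hlt
    · rw [hadd, hIco (left_mem_Ico.2 (lt_add_one p)), h.left, h.right]
    · exact hIco ⟨hx.1, hlt⟩
  have hmono : StrictMono φ :=
    (AddConstMapClass.strictMono_iff_Icc (f := (⟨φ, hadd⟩ : AddConstMap ℝ ℝ 1 1)) one_pos p).2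
      (h.strictMonoOn.congr heq.symm)
  have hsurj : Function.Surjective φ := fun y => by
    have hy : y - ⌊y - p'⌋ ∈ Icc p' (p' + 1) :=
      ⟨by linarith [Int.floor_le (y - p')], by linarith [Int.lt_floor_add_one (y - p')]⟩
    obtain ⟨x, hx, hxy⟩ := h.surjOn hy
    refine ⟨x + ⌊y - p'⌋, ?_⟩
    rw [map_add_intCast hadd, heq hx, hxy, one_mul, sub_add_cancel]
  exact ⟨hmono.orderIsoOfSurjective _ hsurj, hadd, heq⟩

/-! ### Lifts with one attracting gap -/

/-- A `C¹` lift of degree `d` with fixed points `p < q < r < p + 1`, for which `q` attracts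
`(p, r)` and which expands `[r, p + 1]` by at least the factor `κ > 1`. This is the normal form of
the maps near `f_{ε,δ}`: modulo `1` the fixed point `q` is the sink and `(p, r)` its immediate
basin. -/
structure IsGapLift (d : ℕ) (κ p q r : ℝ) (F : ℝ → ℝ) : Prop where
  lt_pq : p < q
  lt_qr : q < r
  lt_rp : r < p + 1
  one_lt : 1 < κ
  contDiff : ContDiff ℝ 1 F
  strictMono : StrictMono F
  map_add_one : ∀ x, F (x + 1) = F x + d
  map_p : F p = p
  map_q : F q = q
  map_r : F r = r
  lt_map : ∀ x ∈ Ioo p q, x < F x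
  map_lt : ∀ x ∈ Ioo q r, F x < x
  le_deriv : ∀ x ∈ Icc r (p + 1), κ ≤ deriv F x

namespace IsGapLift

variable {d : ℕ} {κ p q r κ' p' q' r' : ℝ}

lemma mul_sub_le {F : ℝ → ℝ} (h : IsGapLift d κ p q r F) {x y : ℝ} (hx : x ∈ Icc r (p + 1))
    (hy : y ∈ Icc r (p + 1)) (hxy : x ≤ y) : κ * (y - x) ≤ F y - F x :=
  (convex_Icc r (p + 1)).mul_sub_le_image_sub_of_le_deriv h.contDiff.continuous.continuousOn
    (h.contDiff.differentiable one_ne_zero).differentiableOn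
    (fun z hz => h.le_deriv z (interior_subset hz)) x hx y hy hxy

lemma mul_dist_le {F : ℝ → ℝ} (h : IsGapLift d κ p q r F) {x y : ℝ} (hx : x ∈ Icc r (p + 1))
    (hy : y ∈ Icc r (p + 1)) : κ * dist x y ≤ dist (F x) (F y) := by
  wlog hxy : x ≤ y generalizing x y
  · rw [dist_comm, dist_comm (F x)]
    exact this hy hx (le_of_not_ge hxy)
  rw [dist_comm, dist_comm (F x), Real.dist_eq, Real.dist_eq, abs_of_nonneg (sub_nonneg.2 hxy)]
  exact (h.mul_sub_le hx hy hxy).trans (le_abs_self _)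

lemma map_mem_Icc {F : ℝ → ℝ} (h : IsGapLift d κ p q r F) {x : ℝ} (hx : x ∈ Icc p r) :
    F x ∈ Icc p r :=
  ⟨h.map_p ▸ h.strictMono.monotone hx.1, h.map_r ▸ h.strictMono.monotone hx.2⟩

variable {F G Φ : ℝ ≃ₜ ℝ}

lemma approxConj_eqOn (hF : IsGapLift d κ p q r F) (hconj : ∀ x ∈ Icc p r, Φ (F x) = G (Φ x))
    (n : ℕ) : EqOn (approxConj F G Φ n) Φ (Icc p r) := by
  induction n with
  | zero => exact fun _ _ => rfl
  | succ n ih =>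
    intro x hx
    rw [approxConj_succ, ih (hF.map_mem_Icc hx), hconj x hx, G.symm_apply_apply]

lemma approxConj_mapsTo (hF : IsGapLift d κ p q r F) (hG : IsGapLift d κ' p' q' r' G)
    (hΦ : ∀ x, Φ (x + 1) = Φ x + 1) (hmono : Monotone Φ) (hp : Φ p = p') (hr : Φ r = r')
    (hconj : ∀ x ∈ Icc p r, Φ (F x) = G (Φ x)) (n : ℕ) :
    MapsTo (approxConj F G Φ n) (Icc r (p + 1)) (Icc r' (p' + 1)) := by
  have hpr := hF.lt_pq.trans hF.lt_qr
  have hgap := hF.approxConj_eqOn hconj n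
  have hmono := monotone_approxConj hF.strictMono.monotone hG.strictMono hmono n
  intro x hx
  rw [← hr, ← hp, ← hgap (left_mem_Icc.2 hpr.le), ← hgap (right_mem_Icc.2 hpr.le),
    ← approxConj_add_one hF.map_add_one hG.map_add_one hΦ]
  exact ⟨hmono hx.1, hmono hx.2⟩

lemma mul_dist_approxConj_le (hF : IsGapLift d κ p q r F) (hG : IsGapLift d κ' p' q' r' G)
    (hΦ : ∀ x, Φ (x + 1) = Φ x + 1) (hmono : Monotone Φ) (hp : Φ p = p') (hr : Φ r = r')
    (hconj : ∀ x ∈ Icc p r, Φ (F x) = G (Φ x)) (n : ℕ) (x : ℝ) :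
    κ' * dist (approxConj F G Φ n x) (approxConj F G Φ (n + 1) x) ≤
      dist (G (approxConj F G Φ n x)) (G (approxConj F G Φ (n + 1) x)) := by
  have hmaps := hF.approxConj_mapsTo hG hΦ hmono hp hr hconj
  have hperiod : ∀ x ∈ Icc p (p + 1),
      κ' * dist (approxConj F G Φ n x) (approxConj F G Φ (n + 1) x) ≤
      dist (G (approxConj F G Φ n x)) (G (approxConj F G Φ (n + 1) x)) := by
    intro x hx
    rcases le_total x r with h | h
    · rw [hF.approxConj_eqOn hconj _ ⟨hx.1, h⟩, hF.approxConj_eqOn hconj _ ⟨hx.1, h⟩, dist_self,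
        mul_zero, dist_self]
    · exact hG.mul_dist_le (hmaps n ⟨h, hx.2⟩) (hmaps (n + 1) ⟨h, hx.2⟩)
  have hadd : ∀ m y, approxConj F G Φ m (y + ⌊x - p⌋) = approxConj F G Φ m y + ⌊x - p⌋ :=
    fun m y => by
      rw [map_add_intCast (approxConj_add_one hF.map_add_one hG.map_add_one hΦ m), one_mul]
  have hx := hperiod (x - ⌊x - p⌋)
    ⟨by linarith [Int.floor_le (x - p)], by linarith [Int.lt_floor_add_one (x - p)]⟩
  have hshift : ∀ m, approxConj F G Φ m x = approxConj F G Φ m (x - ⌊x - p⌋) + ⌊x - p⌋ :=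
    fun m => by rw [← hadd, sub_add_cancel]
  simpa only [hshift, map_add_intCast hG.map_add_one, dist_add_right] using hx

lemma exists_orderIso_conj_on_gap {F G : ℝ ≃o ℝ} (hF : IsGapLift d κ p q r F)
    (hG : IsGapLift d κ' p' q' r' G) :
    ∃ Φ : ℝ ≃o ℝ, (∀ x, Φ (x + 1) = Φ x + 1) ∧ Φ p = p' ∧ Φ r = r' ∧
      ∀ x ∈ Icc p r, Φ (F x) = G (Φ x) := by
  have hpr := hF.lt_pq.le.trans hF.lt_qr.le
  obtain ⟨ψ₁, h₁, hconj₁⟩ := exists_isIncreasingBij_conj_of_lt_map hF.lt_pq hG.lt_pq hF.map_p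
    hF.map_q hG.map_p hG.map_q hF.lt_map hG.lt_map
  obtain ⟨ψ₂, h₂, hconj₂⟩ := exists_isIncreasingBij_conj_of_map_lt hF.lt_qr hG.lt_qr hF.map_q
    hF.map_r hG.map_q hG.map_r hF.map_lt hG.map_lt
  obtain ⟨ψ₃, h₃⟩ := exists_isIncreasingBij hF.lt_rp hG.lt_rp
  obtain ⟨ψ₁₂, h₁₂, e₁, e₂⟩ := h₁.exists_glue h₂ hF.lt_pq.le hF.lt_qr.le
  obtain ⟨ψ, h, e₁₂, -⟩ := h₁₂.exists_glue h₃ hpr hF.lt_rp.le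
  obtain ⟨Φ, hΦ, e⟩ := h.exists_orderIso_eqOn
  have hgap : EqOn Φ ψ₁₂ (Icc p r) := (e.mono (Icc_subset_Icc_right hF.lt_rp.le)).trans e₁₂
  refine ⟨Φ, hΦ, (hgap (left_mem_Icc.2 hpr)).trans h₁₂.left,
    (hgap (right_mem_Icc.2 hpr)).trans h₁₂.right, fun x hx => ?_⟩
  have hFx := hF.map_mem_Icc hx
  rw [hgap hx, hgap hFx]
  rcases le_total x q with hxq | hxq
  · rw [e₁ ⟨hFx.1, hF.map_q ▸ F.monotone hxq⟩, e₁ ⟨hx.1, hxq⟩, hconj₁ x ⟨hx.1, hxq⟩]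
  · rw [e₂ ⟨hF.map_q ▸ F.monotone hxq, hFx.2⟩, e₂ ⟨hxq, hx.2⟩, hconj₂ x ⟨hxq, hx.2⟩]

lemma two_le_degree {F : ℝ → ℝ} (h : IsGapLift d κ p q r F) : 2 ≤ d := by
  have hexp := h.mul_sub_le (left_mem_Icc.2 h.lt_rp.le) (right_mem_Icc.2 h.lt_rp.le) h.lt_rp.le
  rw [h.map_add_one, h.map_p, h.map_r] at hexp
  have hlen := lt_mul_of_one_lt_left (sub_pos.2 h.lt_rp) h.one_lt
  have : (1 : ℝ) < d := by linarith
  exact_mod_cast this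

theorem liftConj {F G : ℝ → ℝ} (hF : IsGapLift d κ p q r F) (hG : IsGapLift d κ' p' q' r' G) :
    LiftConj F G := by
  obtain ⟨F, rfl⟩ := exists_orderIso_of_degree (two_pos.trans_le hF.two_le_degree)
    hF.strictMono hF.contDiff.continuous hF.map_add_one
  obtain ⟨G, rfl⟩ := exists_orderIso_of_degree (two_pos.trans_le hG.two_le_degree)
    hG.strictMono hG.contDiff.continuous hG.map_add_one
  obtain ⟨Φ, hΦ, hp, hr, hconj⟩ := hF.exists_orderIso_conj_on_gap hG
  have hp' : Φ.symm p' = p := Φ.symm_apply_eq.2 hp.symm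
  have hr' : Φ.symm r' = r := Φ.symm_apply_eq.2 hr.symm
  have hconj' : ∀ y ∈ Icc p' r', Φ.symm (G y) = F (Φ.symm y) := fun y hy => by
    have hx : Φ.symm y ∈ Icc p r :=
      ⟨hp' ▸ Φ.symm.monotone hy.1, hr' ▸ Φ.symm.monotone hy.2⟩
    rw [Φ.symm_apply_eq, hconj _ hx, Φ.apply_symm_apply]
  exact liftConj_of_approxConj (F := F.toHomeomorph) (G := G.toHomeomorph)
    (Φ := Φ.toHomeomorph) hF.map_add_one hG.map_add_one hΦ hG.one_lt hF.one_lt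
    (mul_dist_approxConj_le hF hG hΦ Φ.monotone hp hr hconj)
    (mul_dist_approxConj_le hG hF (symm_map_add_one hΦ) Φ.symm.monotone hp' hr' hconj')

end IsGapLift

/-! ### Structural stability from lifts -/

lemma C1Close.exists_lift {f g : UnitAddCircle → UnitAddCircle} {F : ℝ → ℝ} {d : ℕ} {η : ℝ}
    (h : C1Close η f g) (hη : η ≤ 1 / 2) (hF : IsC1Lift F f) (hdeg : ∀ x, F (x + 1) = F x + d) :
    ∃ G : ℝ → ℝ, IsC1Lift G g ∧ (∀ x, G (x + 1) = G x + d) ∧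
      ∀ t, |F t - G t| < η ∧ |deriv F t - deriv G t| < η := by
  obtain ⟨F₁, G₁, hF₁, hG₁, hclose⟩ := h
  obtain ⟨k, hk⟩ := exists_int_eq_add_of_lifts hF.1.continuous hF₁.1.continuous
    (fun t => by rw [← hF.2, hF₁.2])
  set G : ℝ → ℝ := fun t => G₁ t - k
  have hclose' : ∀ t, |F t - G t| < η ∧ |deriv F t - deriv G t| < η := by
    intro t
    obtain ⟨h₀, h₁⟩ := hclose t
    rw [hk t, ← sub_sub_eq_add_sub] at h₀
    rw [funext hk, deriv_add_const, ← deriv_sub_const (f := G₁) (k : ℝ)] at h₁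
    exact ⟨h₀, h₁⟩
  have hlift : ∀ t : ℝ, g t = (G t : UnitAddCircle) := fun t => by
    rw [hG₁.2, ← coe_add_int (G t) k, sub_add_cancel]
  refine ⟨G, ⟨hG₁.1.sub contDiff_const, hlift⟩, fun x => ?_, hclose'⟩
  have hcoe : (G x : UnitAddCircle) = G (x + 1) := by
    rw [← hlift, ← hlift, AddCircle.coe_add_period]
  obtain ⟨m, hm⟩ := coe_eq_coe_iff_exists_int.1 hcoe
  have hx := abs_lt.1 (hclose' x).1
  have hx' := abs_lt.1 (hclose' (x + 1)).1
  rw [hm, hdeg] at hx'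
  have hlt : (m : ℝ) < d + 1 := by linarith
  have hgt : (d : ℝ) < m + 1 := by linarith
  have hmd : m = d := le_antisymm (Int.lt_add_one_iff.1 (mod_cast hlt))
    (Int.lt_add_one_iff.1 (mod_cast hgt))
  rw [hm, hmd, Int.cast_natCast]

theorem isStructurallyStable_of_lift {f : UnitAddCircle → UnitAddCircle} {F : ℝ → ℝ} {d : ℕ}
    (hF : IsC1Lift F f) (hdeg : ∀ x, F (x + 1) = F x + d)
    (hconj : ∀ᶠ η in 𝓝[>] (0 : ℝ), ∀ G : ℝ → ℝ, ContDiff ℝ 1 G → (∀ x, G (x + 1) = G x + d) →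
      (∀ t, |F t - G t| < η ∧ |deriv F t - deriv G t| < η) → LiftConj F G) :
    IsStructurallyStable f := by
  obtain ⟨η, hη, hη0, hη2⟩ := (hconj.and (Ioc_mem_nhdsGT (one_half_pos (α := ℝ)))).exists
  refine ⟨⟨F, hF⟩, η, hη0, fun g hg => ?_⟩
  obtain ⟨G, hG, hGdeg, hclose⟩ := hg.exists_lift hη2 hF hdeg
  exact (hη G hG.1 hGdeg hclose).exists_homeomorph_semiconj hF.2 hG.2

section Close

variable {X : Type*} [TopologicalSpace X] {K : Set X} {f c : X → ℝ}

lemma eventually_forall_close_lt (hK : IsCompact K) (hf : ContinuousOn f K)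
    (hc : ContinuousOn c K) (h : ∀ x ∈ K, c x < f x) :
    ∀ᶠ η in 𝓝[>] (0 : ℝ), ∀ g : X → ℝ, (∀ x, |f x - g x| < η) → ∀ x ∈ K, c x < g x := by
  obtain ⟨m, hm, hle⟩ := hK.exists_forall_le' (hf.sub hc) fun x hx => sub_pos.2 (h x hx)
  filter_upwards [Ioc_mem_nhdsGT hm] with η hη g hg x hx
  have hmx : m ≤ f x - c x := hle x hx
  linarith [(abs_lt.1 (hg x)).2, hη.2]

lemma eventually_forall_close_gt (hK : IsCompact K) (hf : ContinuousOn f K)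
    (hc : ContinuousOn c K) (h : ∀ x ∈ K, f x < c x) :
    ∀ᶠ η in 𝓝[>] (0 : ℝ), ∀ g : X → ℝ, (∀ x, |f x - g x| < η) → ∀ x ∈ K, g x < c x := by
  filter_upwards [eventually_forall_close_lt hK hf.neg hc.neg fun x hx => neg_lt_neg (h x hx)]
    with η hη g hg x hx
  refine neg_lt_neg_iff.1 (hη (fun x => -g x) (fun y => ?_) x hx)
  rw [Pi.neg_apply, neg_sub_neg, abs_sub_comm]
  exact hg y

end Close

/-! ### Robustness of the gap -/

lemma deriv_add_one {F : ℝ → ℝ} {c : ℝ} (hF : ∀ x, F (x + 1) = F x + c) (x : ℝ) :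
    deriv F (x + 1) = deriv F x := by
  rw [← deriv_comp_add_const, funext hF, deriv_add_const]

lemma strictMonoOn_sub_id {G : ℝ → ℝ} (hG : Differentiable ℝ G) {a b : ℝ}
    (h : ∀ x ∈ Icc a b, 1 < deriv G x) : StrictMonoOn (fun x => G x - x) (Icc a b) := by
  refine strictMonoOn_of_deriv_pos (convex_Icc a b)
    (hG.continuous.sub continuous_id).continuousOn fun x hx => ?_
  rw [((hG x).hasDerivAt.fun_sub (hasDerivAt_id' x)).deriv]
  exact sub_pos.2 (h x (interior_subset hx))

lemma strictAntiOn_sub_id {G : ℝ → ℝ} (hG : Differentiable ℝ G) {a b : ℝ}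
    (h : ∀ x ∈ Icc a b, deriv G x < 1) : StrictAntiOn (fun x => G x - x) (Icc a b) := by
  refine strictAntiOn_of_deriv_neg (convex_Icc a b)
    (hG.continuous.sub continuous_id).continuousOn fun x hx => ?_
  rw [((hG x).hasDerivAt.fun_sub (hasDerivAt_id' x)).deriv]
  exact sub_neg.2 (h x (interior_subset hx))

/-- Finitely many strict inequalities over compact intervals that make `G` a gap lift whose fixed
points are confined to `[p₁, p₂]`, `[a, b]` and `[r₁, r₂]`. In contrast to `IsGapLift` this is
visibly an open condition in the `C¹` topology. -/
structure IsGapFrame (d : ℕ) (p₁ p₂ a b r₁ r₂ : ℝ) (G : ℝ → ℝ) : Prop where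
  lt_p : p₁ < p₂
  lt_pa : p₂ < a
  lt_ab : a < b
  lt_br : b < r₁
  lt_r : r₁ < r₂
  lt_rp : r₂ < p₁ + 1
  contDiff : ContDiff ℝ 1 G
  map_add_one : ∀ x, G (x + 1) = G x + d
  deriv_pos : ∀ x, 0 < deriv G x
  one_lt_deriv : ∀ x ∈ Icc r₁ (p₂ + 1), 1 < deriv G x
  deriv_lt_one : ∀ x ∈ Icc a b, deriv G x < 1
  map_lt_p₁ : G p₁ < p₁
  lt_map : ∀ x ∈ Icc p₂ a, x < G x
  map_lt : ∀ x ∈ Icc b r₁, G x < x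
  lt_map_r₂ : r₂ < G r₂

namespace IsGapFrame

variable {d : ℕ} {p₁ p₂ a b r₁ r₂ : ℝ} {G : ℝ → ℝ}

lemma exists_fixedPoints (h : IsGapFrame d p₁ p₂ a b r₁ r₂ G) :
    ∃ p ∈ Icc p₁ p₂, ∃ q ∈ Icc a b, ∃ r ∈ Icc r₁ r₂, G p = p ∧ G q = q ∧ G r = r := by
  have hc : Continuous fun x => G x - x := h.contDiff.continuous.sub continuous_id
  have hp₂ := h.lt_map p₂ (left_mem_Icc.2 h.lt_pa.le)
  have ha := h.lt_map a (right_mem_Icc.2 h.lt_pa.le)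
  have hb := h.map_lt b (left_mem_Icc.2 h.lt_br.le)
  have hr₁ := h.map_lt r₁ (right_mem_Icc.2 h.lt_br.le)
  obtain ⟨p, hp, hGp⟩ := intermediate_value_Icc h.lt_p.le hc.continuousOn
    ⟨(sub_neg.2 h.map_lt_p₁).le, (sub_pos.2 hp₂).le⟩
  obtain ⟨q, hq, hGq⟩ := intermediate_value_Icc' h.lt_ab.le hc.continuousOn
    ⟨(sub_neg.2 hb).le, (sub_pos.2 ha).le⟩
  obtain ⟨r, hr, hGr⟩ := intermediate_value_Icc h.lt_r.le hc.continuousOn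
    ⟨(sub_neg.2 hr₁).le, (sub_pos.2 h.lt_map_r₂).le⟩
  exact ⟨p, hp, q, hq, r, hr, sub_eq_zero.1 hGp, sub_eq_zero.1 hGq, sub_eq_zero.1 hGr⟩

lemma lt_map_of_mem_Ioo (h : IsGapFrame d p₁ p₂ a b r₁ r₂ G) {p q : ℝ} (hp : p ∈ Icc p₁ p₂)
    (hq : q ∈ Icc a b) (hGp : G p = p) (hGq : G q = q) : ∀ x ∈ Ioo p q, x < G x := by
  intro x hx
  have hdiff := h.contDiff.differentiable one_ne_zero
  rcases le_total x p₂ with hxp | hxp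
  · have hmono : StrictMonoOn (fun x => G x - x) (Icc p₁ p₂) :=
      strictMonoOn_sub_id hdiff fun y hy => by
        rw [← deriv_add_one h.map_add_one]
        exact h.one_lt_deriv _ ⟨by linarith [h.lt_r, h.lt_rp, hy.1], by linarith [hy.2]⟩
    have : G p - p < G x - x := hmono hp ⟨hp.1.trans hx.1.le, hxp⟩ hx.1
    linarith
  rcases le_total x a with hxa | hxa
  · exact h.lt_map x ⟨hxp, hxa⟩
  · have : G q - q < G x - x :=
      strictAntiOn_sub_id hdiff h.deriv_lt_one ⟨hxa, hx.2.le.trans hq.2⟩ hq hx.2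
    linarith

lemma map_lt_of_mem_Ioo (h : IsGapFrame d p₁ p₂ a b r₁ r₂ G) {q r : ℝ} (hq : q ∈ Icc a b)
    (hr : r ∈ Icc r₁ r₂) (hGq : G q = q) (hGr : G r = r) : ∀ x ∈ Ioo q r, G x < x := by
  intro x hx
  have hdiff := h.contDiff.differentiable one_ne_zero
  rcases le_total r₁ x with hxr | hxr
  · have hrp : r ≤ p₂ + 1 := by linarith [hr.2, h.lt_rp, h.lt_p]
    have : G x - x < G r - r :=
      strictMonoOn_sub_id hdiff h.one_lt_deriv ⟨hxr, hx.2.le.trans hrp⟩ ⟨hr.1, hrp⟩ hx.2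
    linarith
  rcases le_total b x with hxb | hxb
  · exact h.map_lt x ⟨hxb, hxr⟩
  · have : G x - x < G q - q :=
      strictAntiOn_sub_id hdiff h.deriv_lt_one hq ⟨hq.1.trans hx.1.le, hxb⟩ hx.1
    linarith

lemma exists_isGapLift (h : IsGapFrame d p₁ p₂ a b r₁ r₂ G) :
    ∃ κ p q r, IsGapLift d κ p q r G := by
  obtain ⟨p, hp, q, hq, r, hr, hGp, hGq, hGr⟩ := h.exists_fixedPoints
  obtain ⟨κ, hκ, hle⟩ := isCompact_Icc.exists_forall_le'
    (h.contDiff.continuous_deriv le_rfl).continuousOn h.one_lt_deriv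
  exact ⟨κ, p, q, r, hp.2.trans_lt (h.lt_pa.trans_le hq.1), hq.2.trans_lt (h.lt_br.trans_le hr.1),
    by linarith [hr.2, h.lt_rp, hp.1], hκ, h.contDiff, strictMono_of_deriv_pos h.deriv_pos,
    h.map_add_one, hGp, hGq, hGr, h.lt_map_of_mem_Ioo hp hq hGp hGq,
    h.map_lt_of_mem_Ioo hq hr hGq hGr,
    fun x hx => hle x ⟨hr.1.trans hx.1, hx.2.trans (by linarith [hp.2])⟩⟩

lemma eventually_forall_close (h : IsGapFrame d p₁ p₂ a b r₁ r₂ G) :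
    ∀ᶠ η in 𝓝[>] (0 : ℝ), ∀ H : ℝ → ℝ, ContDiff ℝ 1 H → (∀ x, H (x + 1) = H x + d) →
      (∀ t, |G t - H t| < η ∧ |deriv G t - deriv H t| < η) →
      IsGapFrame d p₁ p₂ a b r₁ r₂ H := by
  have hc := h.contDiff.continuous
  have hc' := h.contDiff.continuous_deriv le_rfl
  filter_upwards [
    eventually_forall_close_lt isCompact_Icc hc'.continuousOn continuousOn_const
      fun x (_ : x ∈ Icc 0 1) => h.deriv_pos x,
    eventually_forall_close_lt isCompact_Icc hc'.continuousOn continuousOn_const h.one_lt_deriv,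
    eventually_forall_close_gt isCompact_Icc hc'.continuousOn continuousOn_const h.deriv_lt_one,
    eventually_forall_close_gt (isCompact_singleton (x := p₁)) hc.continuousOn continuousOn_id
      (forall_eq.2 h.map_lt_p₁),
    eventually_forall_close_lt isCompact_Icc hc.continuousOn continuousOn_id h.lt_map,
    eventually_forall_close_gt isCompact_Icc hc.continuousOn continuousOn_id h.map_lt,
    eventually_forall_close_lt (isCompact_singleton (x := r₂)) hc.continuousOn continuousOn_id
      (forall_eq.2 h.lt_map_r₂)]
    with η hpos hout hin hp₁ hlt hgt hr₂ H hH hdeg hclose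
  have hclose₀ := fun t => (hclose t).1
  have hclose₁ := fun t => (hclose t).2
  have hderiv_pos : ∀ x, 0 < deriv H x := fun x => by
    have hperiodic : Function.Periodic (deriv H) 1 := deriv_add_one hdeg
    rw [← hperiodic.sub_int_mul_eq ⌊x⌋, mul_one]
    exact hpos _ hclose₁ _ ⟨Int.fract_nonneg x, (Int.fract_lt_one x).le⟩
  exact ⟨h.lt_p, h.lt_pa, h.lt_ab, h.lt_br, h.lt_r, h.lt_rp, hH, hdeg, hderiv_pos,
    hout _ hclose₁, hin _ hclose₁, hp₁ _ hclose₀ _ rfl, hlt _ hclose₀, hgt _ hclose₀,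
    hr₂ _ hclose₀ _ rfl⟩

theorem eventually_forall_close_liftConj (h : IsGapFrame d p₁ p₂ a b r₁ r₂ G) :
    ∀ᶠ η in 𝓝[>] (0 : ℝ), ∀ H : ℝ → ℝ, ContDiff ℝ 1 H → (∀ x, H (x + 1) = H x + d) →
      (∀ t, |G t - H t| < η ∧ |deriv G t - deriv H t| < η) → LiftConj G H := by
  filter_upwards [h.eventually_forall_close] with η hη H hH hdeg hclose
  obtain ⟨_, _, _, _, hG⟩ := h.exists_isGapLift
  obtain ⟨_, _, _, _, hH⟩ := (hη H hH hdeg hclose).exists_isGapLift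
  exact hG.liftConj hH

end IsGapFrame

lemma IsGapLift.exists_isGapFrame {F : ℝ → ℝ} {d : ℕ} {κ p a q b r : ℝ}
    (h : IsGapLift d κ p q r F) (hpos : ∀ x, 0 < deriv F x) (hpa : p < a) (haq : a < q)
    (hqb : q < b) (hbr : b < r) (hin : ∀ x ∈ Icc a b, deriv F x < 1) :
    ∃ p₁ p₂ r₁ r₂, IsGapFrame d p₁ p₂ a b r₁ r₂ F := by
  obtain ⟨-, -, hrp, hκ, hF, -, hdeg, hp, -, hr, hlt, hgt, hle⟩ := h
  have hout : ∀ x ∈ Icc r (p + 1), 1 < deriv F x := fun x hx => hκ.trans_le (hle x hx)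
  have hopen : IsOpen {x | 1 < deriv F x} :=
    isOpen_lt continuous_const (hF.continuous_deriv le_rfl)
  have hp_deriv : 1 < deriv F p := deriv_add_one hdeg p ▸ hout _ (right_mem_Icc.2 hrp.le)
  obtain ⟨p₂, hpp₂, hp₂⟩ := mem_nhdsGE_iff_exists_Icc_subset.1
    (mem_nhdsWithin_of_mem_nhds ((hopen.inter isOpen_Iio).mem_nhds ⟨hp_deriv, hpa⟩))
  obtain ⟨r₁, hr₁r, hr₁⟩ := mem_nhdsLE_iff_exists_Icc_subset.1
    (mem_nhdsWithin_of_mem_nhds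
      ((hopen.inter isOpen_Ioi).mem_nhds ⟨hout r (left_mem_Icc.2 hrp.le), hbr⟩))
  have hmono : StrictMonoOn (fun x => F x - x) (Icc r (p + 1)) :=
    strictMonoOn_sub_id (hF.differentiable one_ne_zero) hout
  obtain ⟨r₂, hrr₂, hr₂p⟩ := exists_between hrp
  obtain ⟨s, hr₂s, hsp⟩ := exists_between hr₂p
  have hFs : F s - s < F (p + 1) - (p + 1) :=
    hmono ⟨(hrr₂.trans hr₂s).le, hsp.le⟩ (right_mem_Icc.2 hrp.le) hsp
  have hFr₂ : F r - r < F r₂ - r₂ :=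
    hmono (left_mem_Icc.2 hrp.le) ⟨hrr₂.le, hr₂p.le⟩ hrr₂
  have hFs' : F s = F (s - 1) + d := by rw [← hdeg, sub_add_cancel]
  have hp₂a : p₂ < a := (hp₂ (right_mem_Icc.2 hpp₂.le)).2
  have hbr₁ : b < r₁ := (hr₁ (left_mem_Icc.2 hr₁r.le)).2
  refine ⟨s - 1, p₂, r₁, r₂, by linarith [hpp₂], hp₂a, haq.trans hqb, hbr₁,
    hr₁r.trans hrr₂, by rwa [sub_add_cancel], hF, hdeg, hpos, fun x hx => ?_, hin, ?_,
    fun x hx => hlt x ⟨hpp₂.trans_le hx.1, hx.2.trans_lt haq⟩,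
    fun x hx => hgt x ⟨hqb.trans_le hx.1, hx.2.trans_lt hr₁r⟩, by linarith⟩
  · rcases le_total x r with hxr | hxr
    · exact (hr₁ ⟨hx.1, hxr⟩).1
    rcases le_total x (p + 1) with hxp | hxp
    · exact hout x ⟨hxr, hxp⟩
    · rw [← sub_add_cancel x 1, deriv_add_one hdeg]
      exact (hp₂ ⟨by linarith, by linarith [hx.2]⟩).1
  · rw [hdeg, hp] at hFs
    linarith

/-! ### Expansion outside the gap -/

lemma exists_le_of_mul_le_succ {u : ℕ → ℝ} {κ : ℝ} (hκ : 1 < κ) (h0 : 0 < u 0)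
    (hu : ∀ n, κ * u n ≤ u (n + 1)) (C : ℝ) : ∃ n, C ≤ u n := by
  have hpow : ∀ n, κ ^ n * u 0 ≤ u n := fun n => by
    induction n with
    | zero => simp
    | succ n ih =>
      calc κ ^ (n + 1) * u 0 = κ * (κ ^ n * u 0) := by ring
        _ ≤ κ * u n := by gcongr
        _ ≤ u (n + 1) := hu n
  obtain ⟨n, hn⟩ := pow_unbounded_of_one_lt (C / u 0) hκ
  exact ⟨n, ((div_lt_iff₀ h0).1 hn).le.trans (hpow n)⟩

lemma exists_int_sub_mem_Icc {p r t : ℝ} (hrp : r ≤ p + 1) (ht : ∀ k : ℤ, t - k ∉ Ioo p r) :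
    ∃ k : ℤ, t - k ∈ Icc r (p + 1) := by
  have hle : (⌊t - p⌋ : ℝ) ≤ t - p := Int.floor_le _
  have hlt : t - p < ⌊t - p⌋ + 1 := Int.lt_floor_add_one _
  rcases lt_or_ge (t - ⌊t - p⌋) r with hr | hr
  · have hp : t - ⌊t - p⌋ = p :=
      (not_lt.1 fun hp => ht _ ⟨hp, hr⟩).antisymm (by linarith)
    refine ⟨⌊t - p⌋ - 1, ?_⟩
    push_cast
    exact ⟨by linarith, by linarith⟩
  · exact ⟨_, hr, by linarith⟩

lemma iterate_neg_map_neg (F : ℝ → ℝ) (n : ℕ) (x : ℝ) :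
    (fun y => -F (-y))^[n] x = -F^[n] (-x) := by
  have h : Function.Semiconj Neg.neg (fun y => -F (-y)) F := fun y => neg_neg _
  rw [← (h.iterate_right n).eq, neg_neg]

namespace IsGapLift

variable {d : ℕ} {κ p q r : ℝ} {F : ℝ → ℝ}

lemma lt_pr (h : IsGapLift d κ p q r F) : p < r := h.lt_pq.trans h.lt_qr

lemma neg_map_neg (h : IsGapLift d κ p q r F) :
    IsGapLift d κ (-r) (-q) (-p) (fun x => -F (-x)) where
  lt_pq := neg_lt_neg h.lt_qr
  lt_qr := neg_lt_neg h.lt_pq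
  lt_rp := by linarith [h.lt_rp]
  one_lt := h.one_lt
  contDiff := (h.contDiff.comp contDiff_neg).neg
  strictMono := fun _ _ hxy => neg_lt_neg (h.strictMono (neg_lt_neg hxy))
  map_add_one := fun x => by
    have := h.map_add_one (-(x + 1))
    rw [neg_add, neg_add_cancel_right] at this
    rw [neg_add, this]
    ring
  map_p := by rw [neg_neg, h.map_r]
  map_q := by rw [neg_neg, h.map_q]
  map_r := by rw [neg_neg, h.map_p]
  lt_map := fun x hx => lt_neg.1 (h.map_lt _ ⟨lt_neg.1 hx.2, neg_lt.1 hx.1⟩)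
  map_lt := fun x hx => neg_lt.1 (h.lt_map _ ⟨lt_neg.1 hx.2, neg_lt.1 hx.1⟩)
  le_deriv := fun x hx => by
    have hd : deriv (fun x => -F (-x)) x = deriv F (-x) := by
      rw [deriv.fun_neg, deriv_comp_neg, neg_neg]
    rw [hd, ← deriv_add_one h.map_add_one]
    exact h.le_deriv _ ⟨by linarith [hx.2], by linarith [hx.1]⟩

lemma exists_iterate_add_one_le_left (h : IsGapLift d κ p q r F) {y : ℝ} (hy : y < p) :
    ∃ m, F^[m] y + 1 ≤ p := by
  by_contra! hcon
  have hd : (2 : ℝ) ≤ d := by exact_mod_cast h.two_le_degree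
  have hlt : ∀ m, F^[m] y < p := fun m =>
    (h.strictMono.iterate m hy).trans_eq (Function.iterate_fixed h.map_p m)
  have hgrow : ∀ m, κ * (p - F^[m] y) ≤ p - F^[m + 1] y := fun m => by
    have hr : r ≤ F^[m] y + 1 := by
      by_contra! hc
      have hF := h.strictMono hc
      rw [h.map_add_one, h.map_r, ← Function.iterate_succ_apply' F] at hF
      linarith [hcon (m + 1), h.lt_rp]
    have hexp := h.mul_sub_le (y := p + 1) ⟨hr, by linarith [hlt m]⟩
      (right_mem_Icc.2 h.lt_rp.le) (by linarith [hlt m])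
    rw [h.map_add_one, h.map_add_one, h.map_p, ← Function.iterate_succ_apply' F] at hexp
    linarith
  obtain ⟨m, hm⟩ := exists_le_of_mul_le_succ (u := fun m => p - F^[m] y) h.one_lt
    (sub_pos.2 hy) hgrow 1
  linarith [hcon m]

lemma le_left_of_iterate_lt (h : IsGapLift d κ p q r F) {a b : ℝ}
    (hlen : ∀ m, F^[m] b < F^[m] a + 1) (ha : a < p) : b ≤ p := by
  by_contra! hb
  obtain ⟨m, hm⟩ := h.exists_iterate_add_one_le_left ha
  have hpb := h.strictMono.iterate m hb
  rw [Function.iterate_fixed h.map_p] at hpb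
  linarith [hlen m]

lemma right_le_of_iterate_lt (h : IsGapLift d κ p q r F) {a b : ℝ}
    (hlen : ∀ m, F^[m] b < F^[m] a + 1) (hb : r < b) : r ≤ a := by
  refine neg_le_neg_iff.1 (h.neg_map_neg.le_left_of_iterate_lt (fun m => ?_) (neg_lt_neg hb))
  simp only [iterate_neg_map_neg, neg_neg]
  linarith [hlen m]

lemma mul_sub_le_of_iterate_lt (h : IsGapLift d κ p q r F) {a t b : ℝ}
    (hlen : ∀ m, F^[m] b < F^[m] a + 1) (hat : a < t) (htb : t < b)
    (ht : ∀ k : ℤ, t - k ∉ Ioo p r) : κ * (b - a) ≤ F b - F a := by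
  have hlen_sub : ∀ (k : ℤ) (m : ℕ), F^[m] (b - k) < F^[m] (a - k) + 1 := fun k m => by
    have ha := iterate_map_add_intCast h.map_add_one m (a - k) k
    have hb := iterate_map_add_intCast h.map_add_one m (b - k) k
    rw [sub_add_cancel] at ha hb
    linarith [hlen m]
  obtain ⟨k, hrt, htp⟩ := exists_int_sub_mem_Icc h.lt_rp.le ht
  have hra : r ≤ a - k := h.right_le_of_iterate_lt (hlen_sub k) (by linarith)
  have hbp : b - k ≤ p + 1 := by
    have := h.le_left_of_iterate_lt (hlen_sub (k + 1)) (by push_cast; linarith)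
    push_cast at this
    linarith
  have hexp := h.mul_sub_le (x := a - k) (y := b - k) ⟨hra, by linarith⟩ ⟨by linarith, hbp⟩
    (by linarith)
  have ha := map_add_intCast h.map_add_one (a - k) k
  have hb := map_add_intCast h.map_add_one (b - k) k
  rw [sub_add_cancel] at ha hb
  linarith

lemma exists_iterate_add_one_le (h : IsGapLift d κ p q r F) {a t b : ℝ} (hat : a < t)
    (htb : t < b) (ht : ∀ n, ∀ k : ℤ, F^[n] t - k ∉ Ioo p r) : ∃ n, F^[n] a + 1 ≤ F^[n] b := by
  by_contra! hlen
  have hgrow : ∀ n, κ * (F^[n] b - F^[n] a) ≤ F^[n + 1] b - F^[n + 1] a := fun n => by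
    rw [Function.iterate_succ_apply', Function.iterate_succ_apply']
    refine h.mul_sub_le_of_iterate_lt (fun m => ?_) (h.strictMono.iterate n hat)
      (h.strictMono.iterate n htb) (ht n)
    simpa only [Function.iterate_add_apply] using hlen (m + n)
  obtain ⟨n, hn⟩ := exists_le_of_mul_le_succ (u := fun n => F^[n] b - F^[n] a) h.one_lt
    (sub_pos.2 (hat.trans htb)) hgrow 1
  linarith [hlen n]

lemma iterate_mem_Ioo (h : IsGapLift d κ p q r F) {t : ℝ} (ht : t ∈ Ioo p r) (n : ℕ) :
    F^[n] t ∈ Ioo p r :=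
  ⟨(Function.iterate_fixed h.map_p n).symm.trans_lt (h.strictMono.iterate n ht.1),
    (h.strictMono.iterate n ht.2).trans_eq (Function.iterate_fixed h.map_r n)⟩

lemma eq_of_iterate_eq (h : IsGapLift d κ p q r F) {t : ℝ} (ht : t ∈ Ioo p r) {n : ℕ}
    (hn : n ≠ 0) (hper : F^[n] t = t) : t = q := by
  rcases lt_trichotomy t q with hlt | rfl | hgt
  · exact absurd hper (h.strictMono.strictMono_iterate_of_lt_map (h.lt_map t ⟨ht.1, hlt⟩)
      hn.bot_lt).ne'
  · rfl
  · exact absurd hper (h.strictMono.strictAnti_iterate_of_map_lt (h.map_lt t ⟨hgt, ht.2⟩)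
      hn.bot_lt).ne

lemma exists_wandering_Ioo_of_lt (h : IsGapLift d κ p q r F) {t : ℝ} (ht : t ∈ Ioo p q) :
    ∃ a b, t ∈ Ioo a b ∧ Ioo a b ⊆ Ioo p r ∧ ∀ s ∈ Ioo a b, ∀ n, F^[n + 1] s ∉ Ioo a b := by
  have hnear : ∀ᶠ a in 𝓝[<] t, t < F a ∧ p < a :=
    nhdsWithin_le_nhds (((h.contDiff.continuous.tendsto t).eventually_const_lt
      (h.lt_map t ht)).and (lt_mem_nhds ht.1))
  obtain ⟨a, ⟨htFa, hpa⟩, hat⟩ := (hnear.and self_mem_nhdsWithin).exists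
  have hFaq : F a < q := h.map_q ▸ h.strictMono (hat.trans ht.2)
  refine ⟨a, F a, ⟨hat, htFa⟩, Ioo_subset_Ioo hpa.le (hFaq.trans h.lt_qr).le,
    fun s hs n hmem => hmem.2.not_gt ?_⟩
  have hsFs : s < F s := h.lt_map s ⟨hpa.trans hs.1, hs.2.trans hFaq⟩
  calc F a < F s := h.strictMono hs.1
    _ ≤ F^[n + 1] s := h.strictMono.monotone.monotone_iterate_of_le_map hsFs.le n.succ_pos

lemma exists_wandering_Ioo (h : IsGapLift d κ p q r F) {t : ℝ} (ht : t ∈ Ioo p r) (htq : t ≠ q) :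
    ∃ a b, t ∈ Ioo a b ∧ Ioo a b ⊆ Ioo p r ∧ ∀ s ∈ Ioo a b, ∀ n, F^[n + 1] s ∉ Ioo a b := by
  rcases htq.lt_or_gt with hlt | hgt
  · exact h.exists_wandering_Ioo_of_lt ⟨ht.1, hlt⟩
  obtain ⟨a, b, hab, hsub, hwand⟩ :=
    h.neg_map_neg.exists_wandering_Ioo_of_lt ⟨neg_lt_neg ht.2, neg_lt_neg hgt⟩
  have hneg : ∀ x, x ∈ Ioo (-b) (-a) ↔ -x ∈ Ioo a b := fun x =>
    and_comm.trans (and_congr lt_neg neg_lt)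
  refine ⟨-b, -a, (hneg t).2 hab, fun s hs => ?_, fun s hs n hmem => ?_⟩
  · have := hsub ((hneg s).1 hs)
    exact ⟨neg_lt_neg_iff.1 this.2, neg_lt_neg_iff.1 this.1⟩
  · refine hwand (-s) ((hneg s).1 hs) n ?_
    rw [iterate_neg_map_neg, neg_neg]
    exact (hneg _).1 hmem

end IsGapLift

/-! ### Wandering and non-wandering points -/

section Dynamics

variable {X : Type*} [TopologicalSpace X] {f : X → X} {A : Set X} {x : X}

/-- `f` is locally eventually onto at `x`: every neighbourhood of `x` is mapped onto the whole space
by some positive iterate of `f`. -/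
def IsLocallyEventuallyOntoAt (f : X → X) (x : X) : Prop :=
  ∀ V ∈ 𝓝 x, ∃ n, 1 ≤ n ∧ f^[n] '' V = univ

lemma IsLocallyEventuallyOntoAt.mem_nonWandering (h : IsLocallyEventuallyOntoAt f x) :
    x ∈ nonWandering f := fun V hV => by
  obtain ⟨n, hn, hnV⟩ := h V hV
  exact ⟨n, hn, x, hnV ▸ mem_univ x, mem_of_mem_nhds hV⟩

lemma mem_nonWandering_of_map_eq (h : f x = x) : x ∈ nonWandering f := fun _ hV =>
  ⟨1, le_rfl, x, ⟨x, mem_of_mem_nhds hV, h⟩, mem_of_mem_nhds hV⟩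

lemma notMem_nonWandering_of_iterate_mem (hf : Continuous f) (hA : IsOpen A) (hfA : MapsTo f A A)
    {n : ℕ} (hn : f^[n] x ∉ closure A) (hn' : f^[n + 1] x ∈ A) : x ∉ nonWandering f := by
  intro hx
  have hV : {y | f^[n] y ∈ (closure A)ᶜ ∧ f^[n + 1] y ∈ A} ∈ 𝓝 x :=
    inter_mem ((isClosed_closure.isOpen_compl.preimage (hf.iterate n)).mem_nhds hn)
      ((hA.preimage (hf.iterate (n + 1))).mem_nhds hn')
  obtain ⟨m, hm, _, ⟨y, hy, rfl⟩, hy'⟩ := hx _ hV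
  obtain ⟨k, rfl⟩ := Nat.exists_eq_add_of_le' hm
  refine hy'.1 (subset_closure ?_)
  rw [← Function.iterate_add_apply, show n + (k + 1) = k + (n + 1) by ring,
    Function.iterate_add_apply]
  exact hfA.iterate k hy.2

/-- The points whose orbit under `f` never enters `A`. -/
def avoidingSet {X : Type*} (f : X → X) (A : Set X) : Set X :=
  {x | ∀ n, f^[n] x ∉ A}

lemma disjoint_avoidingSet {X : Type*} (f : X → X) (A : Set X) : Disjoint (avoidingSet f A) A :=
  disjoint_left.2 fun _ hx => hx 0

lemma isClosed_avoidingSet (hf : Continuous f) (hA : IsOpen A) : IsClosed (avoidingSet f A) := by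
  simp only [avoidingSet, Set.ofPred_forall]
  exact isClosed_iInter fun n => hA.isClosed_compl.preimage (hf.iterate n)

lemma iterate_mem_avoidingSet_iff {X : Type*} {f : X → X} {A : Set X} (hfA : MapsTo f A A) {x : X}
    (n : ℕ) : f^[n] x ∈ avoidingSet f A ↔ x ∈ avoidingSet f A := by
  refine ⟨fun hx m hm => hx m ?_, fun hx m => ?_⟩
  · rw [← Function.iterate_add_apply, add_comm, Function.iterate_add_apply]
    exact hfA.iterate n hm
  · rw [← Function.iterate_add_apply]
    exact hx _

lemma preperfect_avoidingSet (hfA : MapsTo f A A) (hne : (avoidingSet f A).Nontrivial)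
    (h : ∀ x ∈ avoidingSet f A, IsLocallyEventuallyOntoAt f x) : Preperfect (avoidingSet f A) := by
  refine fun x hx => accPt_iff_nhds.2 fun V hV => ?_
  obtain ⟨n, -, hn⟩ := h x hx V hV
  obtain ⟨y, hy, hyx⟩ := hne.exists_ne (f^[n] x)
  obtain ⟨v, hv, rfl⟩ : y ∈ f^[n] '' V := hn ▸ mem_univ y
  exact ⟨v, ⟨hv, (iterate_mem_avoidingSet_iff hfA n).1 hy⟩, fun hvx => hyx (hvx ▸ rfl)⟩

lemma interior_avoidingSet_eq_empty (hA : A.Nonempty)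
    (h : ∀ x ∈ avoidingSet f A, IsLocallyEventuallyOntoAt f x) :
    interior (avoidingSet f A) = ∅ := by
  refine eq_empty_of_forall_notMem fun x hx => ?_
  obtain ⟨n, -, hn⟩ := h x (interior_subset hx) _ (mem_interior_iff_mem_nhds.1 hx)
  obtain ⟨y, hy⟩ := hA
  obtain ⟨z, hz, rfl⟩ : y ∈ f^[n] '' avoidingSet f A := hn ▸ mem_univ y
  exact hz n hy

end Dynamics

lemma isTotallyDisconnected_of_interior_eq_empty {S : Set UnitAddCircle} (hS : interior S = ∅) :
    IsTotallyDisconnected S := by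
  intro T hTS hT x hx y hy
  obtain ⟨z, hz⟩ : ∃ z, z ∉ S := by
    by_contra! h
    rw [eq_univ_of_forall h, interior_univ] at hS
    exact univ_nonempty.ne_empty hS
  induction z using QuotientAddGroup.induction_on with | H q => ?_
  let c : UnitAddCircle → ℝ := fun z => AddCircle.equivIco 1 q z
  have hcoe : ∀ z, (c z : UnitAddCircle) = z := fun z => AddCircle.coe_equivIco
  have hcont : ContinuousOn c T := fun z hzT =>
    (continuous_subtype_val.continuousAt.comp (AddCircle.continuousAt_equivIco 1 q
      fun hzq => hz (hzq ▸ hTS hzT))).continuousWithinAt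
  have hord : OrdConnected (c '' T) := (hT.image c hcont).ordConnected
  have hle : ∀ u ∈ T, ∀ v ∈ T, c v ≤ c u := fun u hu v hv => by
    by_contra! huv
    have hsub : ((↑) : ℝ → UnitAddCircle) '' Ioo (c u) (c v) ⊆ S := by
      rintro _ ⟨t, ht, rfl⟩
      obtain ⟨z, hz, rfl⟩ := hord.out (mem_image_of_mem c hu) (mem_image_of_mem c hv)
        (Ioo_subset_Icc_self ht)
      exact (hcoe z).symm ▸ hTS hz
    have hempty := interior_maximal hsub (QuotientAddGroup.isOpenMap_coe _ isOpen_Ioo)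
    rw [hS, subset_empty_iff, image_eq_empty] at hempty
    exact (nonempty_Ioo.2 huv).ne_empty hempty
  rw [← hcoe x, ← hcoe y, (hle y hy x hx).antisymm (hle x hx y hy)]

/-! ### Arcs of the circle -/

lemma eq_of_coe_eq_coe {s t : ℝ} (hst : |t - s| < 1) (h : (s : UnitAddCircle) = t) : s = t := by
  obtain ⟨k, rfl⟩ := coe_eq_coe_iff_exists_int.1 h
  rw [add_sub_cancel_left] at hst
  have hk : k = 0 := Int.abs_lt_one_iff.1 (by exact_mod_cast hst)
  rw [hk, Int.cast_zero, add_zero]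

lemma continuous_of_lift {F : ℝ → ℝ} {f : UnitAddCircle → UnitAddCircle} (hF : Continuous F)
    (hf : ∀ t : ℝ, f t = (F t : UnitAddCircle)) : Continuous f := by
  refine isQuotientMap_quotient_mk'.continuous_iff.2 (?_ : Continuous fun t : ℝ => f t)
  simp only [hf]
  exact (AddCircle.continuous_mk' 1).comp hF

lemma iterate_image_eq_univ {F : ℝ → ℝ} {f : UnitAddCircle → UnitAddCircle} (hc : Continuous F)
    (hf : ∀ t : ℝ, f t = (F t : UnitAddCircle)) {a b : ℝ} (hab : a ≤ b) {n : ℕ}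
    (hn : F^[n] a + 1 ≤ F^[n] b) {V : Set UnitAddCircle}
    (hV : ∀ t ∈ Icc a b, (t : UnitAddCircle) ∈ V) : f^[n] '' V = univ := by
  refine eq_univ_of_forall fun y => ?_
  obtain ⟨s, hs, rfl⟩ : y ∈ ((↑) : ℝ → UnitAddCircle) '' Icc (F^[n] a) (F^[n] a + 1) := by
    rw [AddCircle.coe_image_Icc_eq]
    trivial
  obtain ⟨t, ht, rfl⟩ := intermediate_value_Icc hab (hc.iterate n).continuousOn
    ⟨hs.1, hs.2.trans hn⟩
  exact ⟨t, hV t ht, iterate_coe hf n t⟩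

lemma isLocallyEventuallyOntoAt_of_lift {F : ℝ → ℝ} {f : UnitAddCircle → UnitAddCircle}
    (hc : Continuous F) (hf : ∀ t : ℝ, f t = (F t : UnitAddCircle)) {t : ℝ}
    (h : ∀ a b, a < t → t < b → ∃ n, 1 ≤ n ∧ F^[n] a + 1 ≤ F^[n] b) :
    IsLocallyEventuallyOntoAt f t := fun V hV => by
  have hV' : ((↑) : ℝ → UnitAddCircle) ⁻¹' V ∈ 𝓝 t :=
    (AddCircle.continuous_mk' 1).continuousAt.preimage_mem_nhds hV
  obtain ⟨e, he, hball⟩ := Metric.nhds_basis_closedBall.mem_iff.1 hV'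
  rw [Real.closedBall_eq_Icc] at hball
  obtain ⟨n, hn, hlen⟩ := h (t - e) (t + e) (sub_lt_self t he) (lt_add_of_pos_right t he)
  exact ⟨n, hn, iterate_image_eq_univ hc hf (by linarith) hlen fun s hs => hball hs⟩

/-- The arc of the circle onto which the interval `(a, b)` projects. -/
def openArc (a b : ℝ) : Set UnitAddCircle :=
  ((↑) : ℝ → UnitAddCircle) '' Ioo a b

lemma isOpen_openArc (a b : ℝ) : IsOpen (openArc a b) :=
  QuotientAddGroup.isOpenMap_coe _ isOpen_Ioo

lemma coe_mem_openArc {a b t : ℝ} (k : ℤ) (h : t - k ∈ Ioo a b) :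
    (t : UnitAddCircle) ∈ openArc a b :=
  ⟨_, h, by rw [← coe_add_int (t - k) k, sub_add_cancel]⟩

lemma coe_left_notMem_openArc {a b : ℝ} (hab : b ≤ a + 1) : (a : UnitAddCircle) ∉ openArc a b := by
  rintro ⟨s, hs, hsa⟩
  have hdist : |a - s| < 1 := abs_lt.2 ⟨by linarith [hs.2], by linarith [hs.1]⟩
  exact hs.1.ne' (eq_of_coe_eq_coe hdist hsa)

lemma coe_right_notMem_openArc {a b : ℝ} (hab : b ≤ a + 1) :
    (b : UnitAddCircle) ∉ openArc a b := by
  rintro ⟨s, hs, hsb⟩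
  have hdist : |b - s| < 1 := abs_lt.2 ⟨by linarith [hs.2], by linarith [hs.1]⟩
  exact hs.2.ne (eq_of_coe_eq_coe hdist hsb)

lemma closure_openArc_subset (a b : ℝ) :
    closure (openArc a b) ⊆ ((↑) : ℝ → UnitAddCircle) '' Icc a b :=
  closure_minimal (image_mono Ioo_subset_Icc_self)
    (isCompact_Icc.image (AddCircle.continuous_mk' 1)).isClosed

/-! ### Dynamics of gap lifts -/

lemma pow_le_deriv_iterate {G : ℝ → ℝ} {κ t : ℝ} (hG : Differentiable ℝ G) (hκ : 0 ≤ κ)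
    (h : ∀ n, κ ≤ deriv G (G^[n] t)) (n : ℕ) : κ ^ n ≤ deriv (G^[n]) t := by
  induction n with
  | zero => simp
  | succ n ih =>
    have hchain : deriv (G^[n + 1]) t = deriv G (G^[n] t) * deriv (G^[n]) t := by
      rw [Function.iterate_succ']
      exact deriv_comp t (hG _) (hG.iterate n t)
    rw [hchain, pow_succ']
    exact mul_le_mul (h n) ih (pow_nonneg hκ n) (hκ.trans (h n))

namespace IsGapLift

variable {d : ℕ} {κ p q r : ℝ} {F : ℝ → ℝ} {f : UnitAddCircle → UnitAddCircle}

lemma mapsTo_openArc (h : IsGapLift d κ p q r F) (hf : ∀ t : ℝ, f t = (F t : UnitAddCircle)) :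
    MapsTo f (openArc p r) (openArc p r) := by
  rintro _ ⟨t, ht, rfl⟩
  exact hf t ▸ mem_image_of_mem _ (h.iterate_mem_Ioo ht 1)

lemma coe_mem_openArc (h : IsGapLift d κ p q r F) : (q : UnitAddCircle) ∈ openArc p r :=
  ⟨q, ⟨h.lt_pq, h.lt_qr⟩, rfl⟩

lemma nontrivial_avoidingSet (h : IsGapLift d κ p q r F)
    (hf : ∀ t : ℝ, f t = (F t : UnitAddCircle)) : (avoidingSet f (openArc p r)).Nontrivial := by
  have hp : f p = p := by rw [hf, h.map_p]
  have hr : f r = r := by rw [hf, h.map_r]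
  have hdist : |r - p| < 1 := abs_lt.2 ⟨by linarith [h.lt_pr], by linarith [h.lt_rp]⟩
  refine ⟨p, fun n => ?_, r, fun n => ?_, fun hpr => h.lt_pr.ne (eq_of_coe_eq_coe hdist hpr)⟩
  · rw [Function.iterate_fixed hp]
    exact coe_left_notMem_openArc h.lt_rp.le
  · rw [Function.iterate_fixed hr]
    exact coe_right_notMem_openArc h.lt_rp.le

lemma iterate_sub_notMem_Ioo (hf : ∀ t : ℝ, f t = (F t : UnitAddCircle)) {t : ℝ}
    (ht : (t : UnitAddCircle) ∈ avoidingSet f (openArc p r)) (n : ℕ) (k : ℤ) :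
    F^[n] t - k ∉ Ioo p r := fun hk => by
  refine ht n ?_
  rw [iterate_coe hf]
  exact _root_.coe_mem_openArc k hk

lemma isLocallyEventuallyOntoAt (h : IsGapLift d κ p q r F)
    (hf : ∀ t : ℝ, f t = (F t : UnitAddCircle)) {x : UnitAddCircle}
    (hx : x ∈ avoidingSet f (openArc p r)) : IsLocallyEventuallyOntoAt f x := by
  induction x using QuotientAddGroup.induction_on with | H t => ?_
  refine isLocallyEventuallyOntoAt_of_lift h.contDiff.continuous hf fun a b hat htb => ?_
  obtain ⟨n, hn⟩ := h.exists_iterate_add_one_le hat htb fun n k =>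
    iterate_sub_notMem_Ioo hf hx n k
  have hd : (2 : ℝ) ≤ d := by exact_mod_cast h.two_le_degree
  have hF := h.strictMono.monotone hn
  rw [h.map_add_one, ← Function.iterate_succ_apply' F, ← Function.iterate_succ_apply' F] at hF
  exact ⟨n + 1, n.succ_pos, by linarith⟩

theorem isCantor_avoidingSet (h : IsGapLift d κ p q r F)
    (hf : ∀ t : ℝ, f t = (F t : UnitAddCircle)) : IsCantor (avoidingSet f (openArc p r)) :=
  have hne := h.nontrivial_avoidingSet hf
  have honto := fun _ hx => h.isLocallyEventuallyOntoAt hf hx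
  ⟨hne.nonempty,
    ⟨isClosed_avoidingSet (continuous_of_lift h.contDiff.continuous hf) (isOpen_openArc p r),
      preperfect_avoidingSet (h.mapsTo_openArc hf) hne honto⟩,
    isTotallyDisconnected_of_interior_eq_empty
      (interior_avoidingSet_eq_empty ⟨_, h.coe_mem_openArc⟩ honto)⟩

lemma abs_sub_lt_one (h : IsGapLift d κ p q r F) {s t : ℝ} (hs : s ∈ Ioo p r)
    (ht : t ∈ Ioo p r) : |t - s| < 1 :=
  abs_lt.2 ⟨by linarith [hs.2, ht.1, h.lt_rp], by linarith [hs.1, ht.2, h.lt_rp]⟩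

lemma notMem_nonWandering_of_mem_Ioo (h : IsGapLift d κ p q r F)
    (hf : ∀ t : ℝ, f t = (F t : UnitAddCircle)) {t : ℝ} (ht : t ∈ Ioo p r) (htq : t ≠ q) :
    (t : UnitAddCircle) ∉ nonWandering f := by
  intro hnw
  obtain ⟨a, b, hab, hsub, hwand⟩ := h.exists_wandering_Ioo ht htq
  obtain ⟨m, hm, _, ⟨_, ⟨s, hs, rfl⟩, rfl⟩, s', hs', hss'⟩ :=
    hnw _ ((isOpen_openArc a b).mem_nhds ⟨t, hab, rfl⟩)
  obtain ⟨n, rfl⟩ := Nat.exists_eq_add_of_le' hm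
  have hdist := h.abs_sub_lt_one (hsub hs') (h.iterate_mem_Ioo (hsub hs) (n + 1))
  rw [iterate_coe hf] at hss'
  exact hwand s hs n (eq_of_coe_eq_coe hdist hss' ▸ hs')

lemma notMem_closure_openArc (h : IsGapLift d κ p q r F)
    (hf : ∀ t : ℝ, f t = (F t : UnitAddCircle)) {x : UnitAddCircle} (hx : x ∉ openArc p r)
    (hfx : f x ∈ openArc p r) : x ∉ closure (openArc p r) := by
  intro hcl
  obtain ⟨t, ht, rfl⟩ := closure_openArc_subset p r hcl
  suffices hfix : F t = t from hx (by rwa [hf, hfix] at hfx)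
  rcases ht.1.eq_or_lt with rfl | hpt
  · exact h.map_p
  rcases ht.2.eq_or_lt with rfl | htr
  · exact h.map_r
  · exact absurd ⟨t, ⟨hpt, htr⟩, rfl⟩ hx

theorem nonWandering_eq (h : IsGapLift d κ p q r F) (hf : ∀ t : ℝ, f t = (F t : UnitAddCircle)) :
    nonWandering f = {(q : UnitAddCircle)} ∪ avoidingSet f (openArc p r) := by
  refine Subset.antisymm (fun x hx => or_iff_not_imp_right.2 fun hxa => ?_) (union_subset ?_ ?_)
  · have hxa : ∃ n, f^[n] x ∈ openArc p r := by
      simpa only [avoidingSet, mem_ofPred_eq, not_forall, not_not] using hxa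
    classical
    rcases hn : Nat.find hxa with - | n
    · obtain ⟨t, ht, rfl⟩ : x ∈ openArc p r := (Nat.find_eq_zero hxa).1 hn
      by_contra hxq
      exact h.notMem_nonWandering_of_mem_Ioo hf ht (fun htq => hxq (htq ▸ rfl)) hx
    · have hmem : f^[n + 1] x ∈ openArc p r := hn ▸ Nat.find_spec hxa
      have hnotMem : f^[n] x ∉ openArc p r := Nat.find_min hxa (hn ▸ n.lt_succ_self)
      refine absurd hx (notMem_nonWandering_of_iterate_mem
        (continuous_of_lift h.contDiff.continuous hf) (isOpen_openArc p r) (h.mapsTo_openArc hf)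
        (h.notMem_closure_openArc hf hnotMem ?_) hmem)
      rwa [Function.iterate_succ_apply'] at hmem
  · exact singleton_subset_iff.2 (mem_nonWandering_of_map_eq (by rw [hf, h.map_q]))
  · exact fun x hx => (h.isLocallyEventuallyOntoAt hf hx).mem_nonWandering

lemma le_deriv_of_sub_notMem_Ioo (h : IsGapLift d κ p q r F) {t : ℝ}
    (ht : ∀ k : ℤ, t - k ∉ Ioo p r) : κ ≤ deriv F t := by
  obtain ⟨k, hk⟩ := exists_int_sub_mem_Icc h.lt_rp.le ht
  have hper := map_add_intCast (c := 0) (F := deriv F)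
    (fun y => by rw [deriv_add_one h.map_add_one, add_zero]) (t - k) k
  rw [sub_add_cancel, zero_mul, add_zero] at hper
  exact hper ▸ h.le_deriv _ hk

lemma notMem_avoidingSet_of_isHyperbolicAttracting (h : IsGapLift d κ p q r F)
    (hf : ∀ t : ℝ, f t = (F t : UnitAddCircle)) {n : ℕ} {x : UnitAddCircle}
    (hx : IsHyperbolicAttracting f n x) : x ∉ avoidingSet f (openArc p r) := by
  obtain ⟨hn, -, G, t, hG, rfl, hder⟩ := hx
  intro ht
  obtain ⟨k, hk⟩ := exists_int_eq_add_of_lifts h.contDiff.continuous hG.1.continuous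
    fun t => by rw [← hf, hG.2]
  have hderiv : deriv G = deriv F := by
    rw [funext hk]
    exact funext fun s => deriv_add_const _
  have hpow : κ ^ n ≤ deriv (G^[n]) t :=
    pow_le_deriv_iterate (hG.1.differentiable one_ne_zero) (one_pos.trans h.one_lt).le
      (fun m => hderiv ▸ h.le_deriv_of_sub_notMem_Ioo (iterate_sub_notMem_Ioo hG.2 ht m)) n
  exact (one_lt_pow₀ h.one_lt hn.ne').not_ge (hpow.trans ((le_abs_self _).trans hder.le))

lemma eq_of_isPeriodicPt (h : IsGapLift d κ p q r F) (hf : ∀ t : ℝ, f t = (F t : UnitAddCircle))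
    {n : ℕ} (hn : 0 < n) {x : UnitAddCircle} (hx : Function.IsPeriodicPt f n x)
    (hxa : x ∉ avoidingSet f (openArc p r)) : x = q := by
  obtain ⟨m, hm⟩ : ∃ m, f^[m] x ∈ openArc p r := by
    simpa only [avoidingSet, mem_ofPred_eq, not_forall, not_not] using hxa
  have hmem : f^[n * m] x ∈ openArc p r := by
    rw [← Nat.sub_add_cancel (Nat.le_mul_of_pos_left m hn), Function.iterate_add_apply]
    exact (h.mapsTo_openArc hf).iterate _ hm
  rw [(hx.mul_const m).eq] at hmem
  obtain ⟨t, ht, rfl⟩ := hmem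
  have hper : ((F^[n] t : ℝ) : UnitAddCircle) = t := iterate_coe hf n t ▸ hx
  have hdist := h.abs_sub_lt_one (h.iterate_mem_Ioo ht n) ht
  rw [h.eq_of_iterate_eq ht hn.ne' (eq_of_coe_eq_coe hdist hper)]

theorem eq_of_isHyperbolicAttracting (h : IsGapLift d κ p q r F)
    (hf : ∀ t : ℝ, f t = (F t : UnitAddCircle)) {n : ℕ} {x : UnitAddCircle}
    (hx : IsHyperbolicAttracting f n x) : x = q :=
  h.eq_of_isPeriodicPt hf hx.1 hx.2.1 (h.notMem_avoidingSet_of_isHyperbolicAttracting hf hx)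

end IsGapLift

/-! ### Nonsingular endomorphisms and the linear expanding map -/

lemma linearExpanding_coe (d : ℕ) (t : ℝ) :
    linearExpanding d (t : UnitAddCircle) = (d * t : ℝ) := by
  rw [linearExpanding, ← AddCircle.coe_nsmul, nsmul_eq_mul]

lemma isC1Lift_linearExpanding (d : ℕ) : IsC1Lift (fun t => d * t) (linearExpanding d) :=
  ⟨contDiff_const.mul contDiff_id, linearExpanding_coe d⟩

lemma preimage_linearExpanding {d : ℕ} (hd : 0 < d) (s : ℝ) :
    linearExpanding d ⁻¹' {(s : UnitAddCircle)} =
      (fun j : ℕ => (((s + j) / d : ℝ) : UnitAddCircle)) '' Iio d := by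
  have hd0 : (d : ℝ) ≠ 0 := by positivity
  have hdz : (0 : ℤ) < d := by exact_mod_cast hd
  ext x
  induction x using QuotientAddGroup.induction_on with | H t => ?_
  rw [mem_preimage, linearExpanding_coe, mem_singleton_iff, mem_image]
  constructor
  · intro hts
    obtain ⟨k, hk⟩ := coe_eq_coe_iff_exists_int.1 hts.symm
    obtain ⟨j, hj⟩ := Int.eq_ofNat_of_zero_le (k.emod_nonneg hdz.ne')
    have hjd : j < d := by exact_mod_cast hj ▸ k.emod_lt_of_pos hdz
    have hdiv : (j : ℝ) + d * (k / d : ℤ) = k := by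
      exact_mod_cast hj ▸ k.emod_add_mul_ediv d
    refine ⟨j, hjd, coe_eq_coe_iff_exists_int.2 ⟨k / d, ?_⟩⟩
    field_simp
    linarith
  · rintro ⟨j, -, hj⟩
    rw [← linearExpanding_coe, ← hj, linearExpanding_coe, mul_div_cancel₀ _ hd0]
    exact_mod_cast coe_add_int s j

lemma ncard_preimage_linearExpanding {d : ℕ} (hd : 0 < d) (y : UnitAddCircle) :
    (linearExpanding d ⁻¹' {y}).ncard = d := by
  induction y using QuotientAddGroup.induction_on with | H s => ?_
  have hd0 : (0 : ℝ) < d := by exact_mod_cast hd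
  rw [preimage_linearExpanding hd, InjOn.ncard_image, ← Finset.coe_Iio, ncard_coe_finset,
    Nat.card_Iio]
  intro i hi j hj hij
  have hi' : (i : ℝ) < d := Nat.cast_lt.2 hi
  have hj' : (j : ℝ) < d := Nat.cast_lt.2 hj
  have hclose : |(s + j) / d - (s + i) / d| < 1 := by
    rw [← sub_div, abs_div, abs_of_pos hd0, div_lt_one hd0, abs_lt]
    constructor <;> linarith [i.cast_nonneg (α := ℝ), j.cast_nonneg (α := ℝ)]
  have := eq_of_coe_eq_coe hclose hij
  rw [div_left_inj' hd0.ne'] at this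
  exact_mod_cast add_left_cancel this

lemma exists_eq_linearExpanding_comp {F : ℝ → ℝ} {f : UnitAddCircle → UnitAddCircle} {d : ℕ}
    (hd : 0 < d) (hmono : StrictMono F) (hc : Continuous F) (hF : ∀ x, F (x + 1) = F x + d)
    (hf : ∀ t : ℝ, f t = (F t : UnitAddCircle)) :
    ∃ h : UnitAddCircle ≃ₜ UnitAddCircle, f = linearExpanding d ∘ h := by
  have hd0 : (0 : ℝ) < d := by exact_mod_cast hd
  have hdeg : ∀ x, F (x + 1) / d = F x / d + 1 := fun x => by rw [hF]; field_simp
  obtain ⟨Φ, hΦ⟩ := exists_orderIso_of_degree (F := fun x => F x / d) (d := 1) one_pos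
    (fun x y hxy => div_lt_div_of_pos_right (hmono hxy) hd0) (hc.div_const _)
    (by simpa using hdeg)
  obtain ⟨h, hh⟩ := exists_circle_homeomorph Φ.toHomeomorph (by simpa [hΦ] using hdeg)
  refine ⟨h, funext fun x => ?_⟩
  induction x using QuotientAddGroup.induction_on with | H t => ?_
  simp only [Function.comp_apply, hh, OrderIso.coe_toHomeomorph, hΦ, linearExpanding_coe,
    mul_div_cancel₀ _ hd0.ne', hf]

theorem isNonsingularEndo_of_lift {F : ℝ → ℝ} {f : UnitAddCircle → UnitAddCircle} {d : ℕ}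
    (hd : 0 < d) (hF : IsC1Lift F f) (hdeg : ∀ x, F (x + 1) = F x + d)
    (hpos : ∀ x, 0 < deriv F x) : IsNonsingularEndo d f := by
  have : NeZero d := ⟨hd.ne'⟩
  refine ⟨⟨F, hF, hdeg, fun t => (hpos t).ne'⟩, ?_⟩
  obtain ⟨h, rfl⟩ := exists_eq_linearExpanding_comp hd (strictMono_of_deriv_pos hpos)
    hF.1.continuous hdeg hF.2
  have hcov : IsCoveringMap (linearExpanding d) :=
    (AddCircle.isAddQuotientCoveringMap_nsmul_of_ne_zero (1 : ℝ) d).isCoveringMap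
  have hcard : ∀ y, (linearExpanding d ∘ h ⁻¹' {y}).ncard = d := fun y => by
    rw [preimage_comp, ← h.image_symm, ncard_image_of_injective _ h.symm.injective,
      ncard_preimage_linearExpanding hd]
  exact ⟨fun y => nonempty_of_ncard_ne_zero ((hcard y).trans_ne hd.ne'), hcov.comp_homeomorph h,
    hcard⟩

lemma isNonsingularEndo_linearExpanding {d : ℕ} (hd : 0 < d) :
    IsNonsingularEndo d (linearExpanding d) :=
  isNonsingularEndo_of_lift hd (isC1Lift_linearExpanding d) (fun x => by ring)
    (fun x => by simpa using hd)

lemma mul_dist_le_of_le_deriv {F : ℝ → ℝ} {κ : ℝ} (hF : Differentiable ℝ F)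
    (hκ : ∀ x, κ ≤ deriv F x) (x y : ℝ) : κ * dist x y ≤ dist (F x) (F y) := by
  wlog hxy : y ≤ x generalizing x y
  · simpa only [dist_comm] using this y x (le_of_not_ge hxy)
  rw [Real.dist_eq, Real.dist_eq, abs_of_nonneg (sub_nonneg.2 hxy)]
  exact (mul_sub_le_image_sub_of_le_deriv hF hκ hxy).trans (le_abs_self _)

lemma liftConj_of_le_deriv {F G : ℝ → ℝ} {d : ℕ} {κ : ℝ} (hd : 0 < d) (hκ : 1 < κ)
    (hF : ContDiff ℝ 1 F) (hG : ContDiff ℝ 1 G) (hFdeg : ∀ x, F (x + 1) = F x + d)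
    (hGdeg : ∀ x, G (x + 1) = G x + d) (hF' : ∀ x, κ ≤ deriv F x) (hG' : ∀ x, κ ≤ deriv G x) :
    LiftConj F G := by
  have hκ0 : 0 < κ := one_pos.trans hκ
  have hFe := mul_dist_le_of_le_deriv (hF.differentiable one_ne_zero) hF'
  have hGe := mul_dist_le_of_le_deriv (hG.differentiable one_ne_zero) hG'
  obtain ⟨Φ, rfl⟩ := exists_orderIso_of_degree hd
    (strictMono_of_deriv_pos fun x => hκ0.trans_le (hF' x)) hF.continuous hFdeg
  obtain ⟨Γ, rfl⟩ := exists_orderIso_of_degree hd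
    (strictMono_of_deriv_pos fun x => hκ0.trans_le (hG' x)) hG.continuous hGdeg
  exact liftConj_of_expanding (F := Φ.toHomeomorph) (G := Γ.toHomeomorph) hFdeg hGdeg hκ hκ
    hFe hGe

theorem isStructurallyStable_of_le_deriv {F : ℝ → ℝ} {f : UnitAddCircle → UnitAddCircle} {d : ℕ}
    {κ : ℝ} (hd : 0 < d) (hκ : 1 < κ) (hF : IsC1Lift F f) (hdeg : ∀ x, F (x + 1) = F x + d)
    (hF' : ∀ x, κ ≤ deriv F x) : IsStructurallyStable f := by
  obtain ⟨κ', hκ', hκ'κ⟩ := exists_between hκ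
  refine isStructurallyStable_of_lift hF hdeg ?_
  filter_upwards [Ioc_mem_nhdsGT (sub_pos.2 hκ'κ)] with η hη G hG hGdeg hclose
  refine liftConj_of_le_deriv hd hκ' hF.1 hG hdeg hGdeg (fun x => hκ'κ.le.trans (hF' x))
    fun x => ?_
  linarith [(abs_lt.1 (hclose x).2).2, hF' x, hη.2]

lemma isStructurallyStable_linearExpanding {d : ℕ} (hd : 2 ≤ d) :
    IsStructurallyStable (linearExpanding d) :=
  isStructurallyStable_of_le_deriv (d := d) (by omega) (by exact_mod_cast hd : (1 : ℝ) < d)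
    (isC1Lift_linearExpanding d) (fun x => by ring) (fun x => by simp)

lemma nonWandering_linearExpanding {d : ℕ} (hd : 2 ≤ d) :
    nonWandering (linearExpanding d) = univ := by
  have hd1 : (1 : ℝ) < d := by exact_mod_cast hd
  have hE := isC1Lift_linearExpanding d
  refine eq_univ_of_forall fun x => ?_
  induction x using QuotientAddGroup.induction_on with | H t => ?_
  refine IsLocallyEventuallyOntoAt.mem_nonWandering
    (isLocallyEventuallyOntoAt_of_lift hE.1.continuous hE.2 fun a b hat htb => ?_)
  have hab : 0 < b - a := by linarith
  obtain ⟨n, hn⟩ := exists_le_of_mul_le_succ (κ := d)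
    (u := fun n => (fun t : ℝ => d * t)^[n + 1] b - (fun t : ℝ => d * t)^[n + 1] a) hd1
    (by simpa [← mul_sub] using mul_pos (one_pos.trans hd1) hab)
    (fun n => by simp only [Function.iterate_succ_apply' _ (n + 1), mul_sub, le_refl]) 1
  exact ⟨n + 1, by omega, by linarith⟩

/-! ### Bump functions -/

namespace IsBump

variable {δ : ℝ} {U : ℝ → ℝ}

lemma comp_neg (h : IsBump δ U) : IsBump δ fun x => U (-x) where
  contDiff := h.contDiff.comp contDiff_neg
  eq_one x hx := h.eq_one _ ⟨by linarith [hx.2], by linarith [hx.1]⟩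
  eq_zero x hx := h.eq_zero _ (by rwa [abs_neg])
  deriv_nonneg x hx := by
    rw [deriv_comp_neg]
    linarith [h.deriv_nonpos (-x) ⟨by linarith [hx.2], by linarith [hx.1]⟩]
  deriv_nonpos x hx := by
    rw [deriv_comp_neg]
    linarith [h.deriv_nonneg (-x) ⟨by linarith [hx.2], by linarith [hx.1]⟩]

lemma antitoneOn (h : IsBump δ U) (hδ : 0 < δ) : AntitoneOn U (Ici 0) := by
  have hleft : AntitoneOn U (Icc 0 (δ / 2)) := fun x hx y hy _ => by
    rw [h.eq_one x ⟨by linarith [hx.1], hx.2⟩, h.eq_one y ⟨by linarith [hy.1], hy.2⟩]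
  have hmid : AntitoneOn U (Icc (δ / 2) δ) :=
    antitoneOn_of_deriv_nonpos (convex_Icc _ _) h.contDiff.continuous.continuousOn
      (h.contDiff.differentiable one_ne_zero).differentiableOn
      fun x hx => h.deriv_nonpos x (interior_subset hx)
  have hright : AntitoneOn U (Ici δ) := fun x hx y hy _ => by
    rw [h.eq_zero x (le_trans hx (le_abs_self x)), h.eq_zero y (le_trans hy (le_abs_self y))]
  have hle : δ / 2 ≤ δ := by linarith
  rw [← Icc_union_Ici_eq_Ici hδ.le, ← Icc_union_Icc_eq_Icc (by linarith) hle]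
  refine AntitoneOn.union_right (c := δ) (hleft.union_right hmid (isGreatest_Icc (by linarith))
    (isLeast_Icc hle)) hright ?_ isLeast_Ici
  rw [Icc_union_Icc_eq_Icc (by linarith) hle]
  exact isGreatest_Icc hδ.le

lemma mul_deriv_nonpos (h : IsBump δ U) (hδ : 0 < δ) (x : ℝ) : x * deriv U x ≤ 0 := by
  wlog hx : 0 < x generalizing x U
  · rcases (not_lt.1 hx).eq_or_lt with rfl | hx
    · rw [zero_mul]
    · simpa [deriv_comp_neg] using this h.comp_neg (-x) (neg_pos.2 hx)
  have hderiv : deriv U x ≤ 0 := by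
    rw [← derivWithin_of_mem_nhds (Ici_mem_nhds hx)]
    exact (h.antitoneOn hδ).derivWithin_nonpos
  exact mul_nonpos_of_nonneg_of_nonpos hx.le hderiv

lemma mem_Icc (h : IsBump δ U) (hδ : 0 < δ) (x : ℝ) : U x ∈ Icc 0 1 := by
  wlog hx : 0 ≤ x generalizing x U
  · simpa using this h.comp_neg (-x) (by linarith)
  have hzero : U 0 = 1 := h.eq_one 0 ⟨by linarith, by linarith⟩
  have hmax : U (max x δ) = 0 := h.eq_zero _ ((le_max_right x δ).trans (le_abs_self _))
  exact ⟨hmax ▸ h.antitoneOn hδ hx (hx.trans (le_max_left x δ)) (le_max_left x δ),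
    hzero ▸ h.antitoneOn hδ self_mem_Ici hx hx⟩

lemma deriv_eq_zero (h : IsBump δ U) (hδ : 0 < δ) {x : ℝ} (hx : x ∈ Icc (-(δ / 2)) (δ / 2)) :
    deriv U x = 0 := by
  have hmax : IsMaxOn U univ x := fun y _ => by
    rw [mem_ofPred_eq, h.eq_one x hx]
    exact (h.mem_Icc hδ y).2
  exact (hmax.isLocalMax univ_mem).deriv_eq_zero

lemma abs_mul_le (h : IsBump δ U) (hδ : 0 < δ) (x : ℝ) : |x * U x| ≤ δ := by
  rcases le_total δ |x| with hx | hx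
  · rw [h.eq_zero x hx, mul_zero, abs_zero]
    exact hδ.le
  · obtain ⟨hU₀, hU₁⟩ := h.mem_Icc hδ x
    rw [abs_mul, abs_of_nonneg hU₀]
    exact (mul_le_of_le_one_right (abs_nonneg x) hU₁).trans hx

lemma exists_crossing (h : IsBump δ U) (hδ : 0 < δ) {c : ℝ} (hc : c ∈ Ioo 0 1)
    (hreg : ∀ x, U x = c → deriv U x ≠ 0) :
    ∃ r ∈ Ioo (δ / 2) δ, U r = c ∧ ∀ x, 0 ≤ x → (c < U x ↔ x < r) := by
  have hanti := h.antitoneOn hδ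
  have hone : U (δ / 2) = 1 := h.eq_one _ ⟨by linarith, le_rfl⟩
  have hzero : U δ = 0 := h.eq_zero _ (le_abs_self δ)
  obtain ⟨r, hr, rfl⟩ := intermediate_value_Ioo' (by linarith : δ / 2 ≤ δ)
    h.contDiff.continuous.continuousOn (show c ∈ Ioo (U δ) (U (δ / 2)) by rwa [hone, hzero])
  have hr0 : 0 < r := by linarith [hr.1]
  refine ⟨r, hr, rfl, fun x hx0 => ⟨fun hx => ?_, fun hxr => ?_⟩⟩
  · by_contra! hrx
    exact hx.not_ge (hanti hr0.le hx0 hrx)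
  refine (hanti hx0 hr0.le hxr.le).lt_of_ne fun hrx => ?_
  have hconst : ∀ z ∈ Icc x r, U z = U r := fun z hz => by
    have hz0 : 0 ≤ z := hx0.trans hz.1
    exact le_antisymm (hrx ▸ hanti hx0 hz0 hz.1) (hanti hz0 hr0.le hz.2)
  obtain ⟨y, hxy, hyr⟩ := exists_between hxr
  have hlocal : U =ᶠ[𝓝 y] fun _ => U r := by
    filter_upwards [Icc_mem_nhds hxy hyr] with z hz using hconst z hz
  exact hreg y (hconst y ⟨hxy.le, hyr.le⟩) (by rw [hlocal.deriv_eq, deriv_const])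

lemma exists_lt_iff_mem_Ioo (h : IsBump δ U) (hδ : 0 < δ) {c : ℝ} (hc : c ∈ Ioo 0 1)
    (hreg : ∀ x, U x = c → deriv U x ≠ 0) :
    ∃ p ∈ Ioo (-δ) (-(δ / 2)), ∃ r ∈ Ioo (δ / 2) δ, U p = c ∧ U r = c ∧
      ∀ x, c < U x ↔ x ∈ Ioo p r := by
  obtain ⟨r, hr, hUr, hr_lt⟩ := h.exists_crossing hδ hc hreg
  obtain ⟨s, hs, hUs, hs_lt⟩ := h.comp_neg.exists_crossing hδ hc fun x hx => by
    rw [deriv_comp_neg]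
    exact neg_ne_zero.2 (hreg _ hx)
  refine ⟨-s, ⟨neg_lt_neg hs.2, neg_lt_neg hs.1⟩, r, hr, hUs, hUr, fun x => ?_⟩
  rcases le_total 0 x with hx | hx
  · rw [hr_lt x hx]
    exact ⟨fun hxr => ⟨by linarith [hs.1], hxr⟩, fun hx => hx.2⟩
  · have hx_lt := hs_lt (-x) (neg_nonneg.2 hx)
    rw [neg_neg] at hx_lt
    rw [hx_lt]
    exact ⟨fun hxs => ⟨by linarith, by linarith [hr.1]⟩, fun hx => by linarith [hx.1]⟩

end IsBump

/-! ### The two-parameter family -/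

/-- The lift of `x ↦ d x + (-d + ε) x U(x) mod 1`: the signed distance `x - round x` to the nearest
integer is the coordinate in `[-1/2, 1/2)`. The rounding jumps at half-integers are harmless because
`U` vanishes there. -/
noncomputable def bumpLift (d : ℕ) (ε : ℝ) (U : ℝ → ℝ) (x : ℝ) : ℝ :=
  d * x - (d - ε) * ((x - round x) * U (x - round x))

section BumpLift

variable {d : ℕ} {ε δ : ℝ} {U : ℝ → ℝ}

lemma bumpLift_add_one (x : ℝ) : bumpLift d ε U (x + 1) = bumpLift d ε U x + d := by
  have hround : x + 1 - round (x + 1) = x - round x := by rw [round_add_one]; push_cast; ring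
  rw [bumpLift, bumpLift, hround]
  ring

lemma bumpLift_eq_of_abs_sub_le (hU : IsBump δ U) (hδ : δ < 1 / 4) {x : ℝ} {k : ℤ}
    (hx : |x - k| ≤ 3 / 4) :
    bumpLift d ε U x = d * x - (d - ε) * ((x - k) * U (x - k)) := by
  rw [bumpLift]
  by_cases hk : round x = k
  · rw [hk]
  · have hround : |x - round x| ≤ 1 / 2 := abs_sub_round x
    have hone : (1 : ℝ) ≤ |(round x : ℝ) - k| := by
      exact_mod_cast Int.one_le_abs (sub_ne_zero.2 hk)
    have htri := abs_sub_le (round x : ℝ) x k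
    rw [abs_sub_comm (round x : ℝ) x] at htri
    rw [hU.eq_zero _ (by linarith), hU.eq_zero (x - k) (by linarith)]
    ring

lemma bumpLift_eq (hU : IsBump δ U) (hδ : δ < 1 / 4) {x : ℝ} (hx : |x| ≤ 3 / 4) :
    bumpLift d ε U x = d * x - (d - ε) * (x * U x) := by
  simpa using bumpLift_eq_of_abs_sub_le (k := 0) hU hδ (by simpa using hx)

lemma bumpLift_eventuallyEq (hU : IsBump δ U) (hδ : δ < 1 / 4) {x : ℝ} {k : ℤ}
    (hx : |x - k| < 3 / 4) :
    bumpLift d ε U =ᶠ[𝓝 x] fun y => d * y - (d - ε) * ((y - k) * U (y - k)) := by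
  have hopen : IsOpen {y : ℝ | |y - k| < 3 / 4} := isOpen_lt (by fun_prop) continuous_const
  filter_upwards [hopen.mem_nhds hx] with y hy
  exact bumpLift_eq_of_abs_sub_le hU hδ (le_of_lt hy)

lemma contDiff_bumpLift (hU : IsBump δ U) (hδ : δ < 1 / 4) : ContDiff ℝ 1 (bumpLift d ε U) := by
  rw [contDiff_iff_contDiffAt]
  intro x
  have hx : |x - round x| < 3 / 4 := (abs_sub_round x).trans_lt (by norm_num)
  refine ContDiffAt.congr_of_eventuallyEq ?_ (bumpLift_eventuallyEq hU hδ hx)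
  have := hU.contDiff
  fun_prop

lemma deriv_bumpLift (hU : IsBump δ U) (hδ : δ < 1 / 4) {x : ℝ} (hx : |x| < 3 / 4) :
    deriv (bumpLift d ε U) x = d - (d - ε) * (U x + x * deriv U x) := by
  have hlocal := bumpLift_eventuallyEq (d := d) (ε := ε) (k := 0) hU hδ (by simpa using hx)
  simp only [Int.cast_zero, sub_zero] at hlocal
  have hU' := (hU.contDiff.differentiable one_ne_zero x).hasDerivAt
  have hderiv := ((hasDerivAt_id' x).const_mul (d : ℝ)).fun_sub
    (((hasDerivAt_id' x).fun_mul hU').const_mul ((d : ℝ) - ε))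
  rw [hlocal.deriv_eq, hderiv.deriv, mul_one, one_mul]

lemma deriv_bumpLift_of_mem_Icc (hU : IsBump δ U) (hδ : δ ∈ Ioo (0 : ℝ) (1 / 4)) {x : ℝ}
    (hx : x ∈ Icc (-(δ / 2)) (δ / 2)) : deriv (bumpLift d ε U) x = ε := by
  have habs : |x| < 3 / 4 := (abs_le.2 hx).trans_lt (by linarith [hδ.2])
  rw [deriv_bumpLift hU hδ.2 habs, hU.eq_one x hx, hU.deriv_eq_zero hδ.1 hx]
  ring

lemma deriv_bumpLift_pos (hε : 0 < ε) (hεd : ε ≤ d) (hδ : δ ∈ Ioo (0 : ℝ) (1 / 4))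
    (hU : IsBump δ U) (x : ℝ) : 0 < deriv (bumpLift d ε U) x := by
  have hperiodic : Function.Periodic (deriv (bumpLift d ε U)) 1 := deriv_add_one bumpLift_add_one
  set s := x - round x
  have hxs : deriv (bumpLift d ε U) x = deriv (bumpLift d ε U) s := by
    rw [← hperiodic.sub_int_mul_eq (round x), mul_one]
  rw [hxs, deriv_bumpLift hU hδ.2 ((abs_sub_round x).trans_lt (by norm_num))]
  have hle : U s + s * deriv U s ≤ 1 := by
    linarith [(hU.mem_Icc hδ.1 s).2, hU.mul_deriv_nonpos hδ.1 s]
  linarith [mul_le_mul_of_nonneg_left hle (sub_nonneg.2 hεd)]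

lemma one_lt_deriv_bumpLift (hεd : ε < d) (hδ : δ ∈ Ioo (0 : ℝ) (1 / 4)) (hU : IsBump δ U)
    (hreg : ∀ x, U x = (d - 1) / (d - ε) → deriv U x ≠ 0) {x : ℝ} (hx : |x| < 3 / 4)
    (hUx : U x ≤ (d - 1) / (d - ε)) : 1 < deriv (bumpLift d ε U) x := by
  have hlt : U x + x * deriv U x < (d - 1) / (d - ε) := by
    have hle := hU.mul_deriv_nonpos hδ.1 x
    rcases hUx.eq_or_lt with hUx | hUx
    · have hx0 : x ≠ 0 := by
        rintro rfl
        exact hreg 0 hUx (hU.deriv_eq_zero hδ.1 ⟨by linarith [hδ.1], by linarith [hδ.1]⟩)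
      linarith [hle.lt_of_ne (mul_ne_zero hx0 (hreg x hUx))]
    · linarith
  rw [lt_div_iff₀' (sub_pos.2 hεd)] at hlt
  rw [deriv_bumpLift hU hδ.2 hx]
  linarith

lemma bumpLift_sub_self (hεd : ε < d) (hδ : δ < 1 / 4) (hU : IsBump δ U) {x : ℝ}
    (hx : |x| ≤ 3 / 4) :
    bumpLift d ε U x - x = (d - ε) * (x * ((d - 1) / (d - ε) - U x)) := by
  have hne : (d : ℝ) - ε ≠ 0 := (sub_pos.2 hεd).ne'
  rw [bumpLift_eq hU hδ hx]
  field_simp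
  ring

lemma one_lt_deriv_bumpLift_of_mem_Icc (hεd : ε < d) (hδ : δ ∈ Ioo (0 : ℝ) (1 / 4))
    (hU : IsBump δ U) (hreg : ∀ x, U x = (d - 1) / (d - ε) → deriv U x ≠ 0) {p r : ℝ}
    (hp : -(3 / 4) < p) (hp0 : p < 0) (hr0 : 0 < r)
    (hIoo : ∀ x, (d - 1) / (d - ε) < U x ↔ x ∈ Ioo p r) {x : ℝ} (hx : x ∈ Icc r (p + 1)) :
    1 < deriv (bumpLift d ε U) x := by
  rcases le_total x (1 / 2) with hx2 | hx2
  · refine one_lt_deriv_bumpLift hεd hδ hU hreg (abs_lt.2 ⟨by linarith [hx.1], by linarith⟩) ?_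
    exact not_lt.1 fun hlt => ((hIoo x).1 hlt).2.not_ge hx.1
  · rw [← sub_add_cancel x 1, deriv_add_one bumpLift_add_one]
    refine one_lt_deriv_bumpLift hεd hδ hU hreg
      (abs_lt.2 ⟨by linarith, by linarith [hx.2]⟩) ?_
    exact not_lt.1 fun hlt => ((hIoo _).1 hlt).1.not_ge (by linarith [hx.2])

lemma exists_isGapLift_bumpLift (hd : 2 ≤ d) (hε : ε ∈ Ioo (0 : ℝ) 1)
    (hδ : δ ∈ Ioo (0 : ℝ) (1 / 4)) (hU : IsBump δ U)
    (hreg : ∀ x, U x = (d - 1) / (d - ε) → deriv U x ≠ 0) :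
    ∃ κ p r, p < -(δ / 2) ∧ δ / 2 < r ∧ IsGapLift d κ p 0 r (bumpLift d ε U) := by
  obtain ⟨hδ0, hδ4⟩ := hδ
  have hd2 : (2 : ℝ) ≤ d := by exact_mod_cast hd
  have hεd : ε < d := by linarith [hε.2]
  have hc : ((d : ℝ) - 1) / (d - ε) ∈ Ioo (0 : ℝ) 1 :=
    ⟨div_pos (by linarith) (sub_pos.2 hεd), (div_lt_one (sub_pos.2 hεd)).2 (by linarith [hε.2])⟩
  obtain ⟨p, ⟨hδp, hp⟩, r, ⟨hr, hrδ⟩, hUp, hUr, hIoo⟩ := hU.exists_lt_iff_mem_Ioo hδ0 hc hreg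
  have hsub : ∀ x ∈ Icc p r,
      bumpLift d ε U x - x = (d - ε) * (x * ((d - 1) / (d - ε) - U x)) := fun x hx =>
    bumpLift_sub_self hεd hδ4 hU (abs_le.2 ⟨by linarith [hx.1], by linarith [hx.2]⟩)
  obtain ⟨κ, hκ, hle⟩ := isCompact_Icc.exists_forall_le'
    ((contDiff_bumpLift hU hδ4).continuous_deriv le_rfl).continuousOn fun x hx =>
      one_lt_deriv_bumpLift_of_mem_Icc hεd ⟨hδ0, hδ4⟩ hU hreg (by linarith) (by linarith)
        (by linarith) hIoo hx
  refine ⟨κ, p, r, hp, hr, by linarith, by linarith, by linarith, hκ, contDiff_bumpLift hU hδ4,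
    strictMono_of_deriv_pos (deriv_bumpLift_pos hε.1 hεd.le ⟨hδ0, hδ4⟩ hU), bumpLift_add_one,
    sub_eq_zero.1 ?_, sub_eq_zero.1 ?_, sub_eq_zero.1 ?_, fun x hx => ?_, fun x hx => ?_, hle⟩
  · rw [hsub p ⟨le_rfl, by linarith⟩, hUp, sub_self, mul_zero, mul_zero]
  · rw [hsub 0 ⟨by linarith, by linarith⟩, zero_mul, mul_zero]
  · rw [hsub r ⟨by linarith, le_rfl⟩, hUr, sub_self, mul_zero, mul_zero]
  · have hUx := (hIoo x).2 ⟨hx.1, by linarith [hx.2]⟩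
    rw [← sub_pos, hsub x ⟨hx.1.le, by linarith [hx.2]⟩]
    exact mul_pos (sub_pos.2 hεd) (mul_pos_of_neg_of_neg hx.2 (sub_neg.2 hUx))
  · have hUx := (hIoo x).2 ⟨by linarith [hx.1], hx.2⟩
    rw [← sub_neg, hsub x ⟨by linarith [hx.1], hx.2.le⟩]
    exact mul_neg_of_pos_of_neg (sub_pos.2 hεd) (mul_neg_of_pos_of_neg hx.1 (sub_neg.2 hUx))

end BumpLift

section BifFamily

variable {d : ℕ} {ε δ : ℝ} {U : ℝ → ℝ → ℝ}

lemma isC1Lift_bumpLift (hδ : δ ∈ Ioo (0 : ℝ) (1 / 4)) (hU : IsBump δ (U δ)) :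
    IsC1Lift (bumpLift d ε (U δ)) (bifFamily d U ε δ) := by
  refine ⟨contDiff_bumpLift hU hδ.2, fun t => ?_⟩
  have hmem : t - round t ∈ Ico (-(1 / 2)) (-(1 / 2) + 1 : ℝ) := by
    rw [round_eq]
    constructor <;> linarith [Int.floor_le (t + 1 / 2), Int.lt_floor_add_one (t + 1 / 2)]
  have ht : (t : UnitAddCircle) = (t - round t : ℝ) := by
    rw [← coe_add_int (t - round t) (round t), sub_add_cancel]
  rw [ht, bifFamily, if_neg fun h => hδ.1.ne' h.2, AddCircle.liftIco_coe_apply hmem, bumpLift]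
  refine coe_eq_coe_iff_exists_int.2 ⟨d * round t, ?_⟩
  push_cast
  ring

theorem isNonsingularEndo_bifFamily (hε : 0 < ε) (hεd : ε ≤ d) (hδ : δ ∈ Ioo (0 : ℝ) (1 / 4))
    (hU : IsBump δ (U δ)) : IsNonsingularEndo d (bifFamily d U ε δ) :=
  isNonsingularEndo_of_lift (by exact_mod_cast hε.trans_le hεd) (isC1Lift_bumpLift hδ hU)
    bumpLift_add_one (deriv_bumpLift_pos hε hεd hδ hU)

theorem isHyperbolicAttracting_zero (hε : |ε| < 1) (hδ : δ ∈ Ioo (0 : ℝ) (1 / 4))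
    (hU : IsBump δ (U δ)) : IsHyperbolicAttracting (bifFamily d U ε δ) 1 0 := by
  have hlift := isC1Lift_bumpLift (d := d) (ε := ε) hδ hU
  refine ⟨one_pos, ?_, _, 0, hlift, AddCircle.coe_zero 1, ?_⟩
  · simpa [bumpLift] using hlift.2 0
  · rwa [Function.iterate_one,
      deriv_bumpLift_of_mem_Icc hU hδ ⟨by linarith [hδ.1], by linarith [hδ.1]⟩]

theorem tendstoUniformly_bifFamily (hU : ∀ δ ∈ Ioo (0 : ℝ) (1 / 4), IsBump δ (U δ)) (ε : ℝ) :
    TendstoUniformly (fun δ => bifFamily d U ε δ) (linearExpanding d) (𝓝[>] (0 : ℝ)) := by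
  rw [Metric.tendstoUniformly_iff]
  intro e he
  have hlim : Tendsto (fun δ => |(d : ℝ) - ε| * δ) (𝓝[>] 0) (𝓝 0) :=
    ((continuous_const_mul _).tendsto' 0 0 (mul_zero _)).mono_left nhdsWithin_le_nhds
  filter_upwards [hlim.eventually_lt_const he, Ioo_mem_nhdsGT (by norm_num : (0 : ℝ) < 1 / 4)]
    with δ hδe hδ x
  induction x using QuotientAddGroup.induction_on with | H t => ?_
  rw [linearExpanding_coe, (isC1Lift_bumpLift hδ (hU δ hδ)).2, dist_eq_norm, ← AddCircle.coe_sub]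
  refine QuotientAddGroup.norm_mk_le_norm.trans_lt (lt_of_le_of_lt ?_ hδe)
  rw [bumpLift, sub_sub_cancel, Real.norm_eq_abs, abs_mul]
  exact mul_le_mul_of_nonneg_left ((hU δ hδ).abs_mul_le hδ.1 _) (abs_nonneg _)

end BifFamily

theorem mainTheorem5 (d : ℕ) (hd : 2 ≤ d) (U : ℝ → ℝ → ℝ)
    (hU : ∀ δ ∈ Ioo (0 : ℝ) (1 / 4), IsBump δ (U δ)) :
    (∀ ε ∈ Ioo (0 : ℝ) 1, ∀ δ ∈ Ioo (0 : ℝ) (1 / 4),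
      IsNonsingularEndo d (bifFamily d U ε δ) ∧
      ((∀ x, U δ x = (d - 1) / (d - ε) → deriv (U δ) x ≠ 0) →
        IsStructurallyStable (bifFamily d U ε δ) ∧
        IsHyperbolicAttracting (bifFamily d U ε δ) 1 0 ∧
        (∀ n x, IsHyperbolicAttracting (bifFamily d U ε δ) n x → x = 0) ∧
        ∃ C : Set UnitAddCircle, IsCantor C ∧ (0 : UnitAddCircle) ∉ C ∧
          nonWandering (bifFamily d U ε δ) = {0} ∪ C)) ∧
    (IsNonsingularEndo d (bifFamily d U 0 0) ∧
      IsStructurallyStable (bifFamily d U 0 0) ∧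
      nonWandering (bifFamily d U 0 0) = univ) ∧
    (∀ ε ∈ Ioo (0 : ℝ) 1,
      TendstoUniformly (fun δ => bifFamily d U ε δ) (linearExpanding d) (𝓝[>] (0 : ℝ))) := by
  refine ⟨fun ε hε δ hδ => ?_, ?_, fun ε _ => tendstoUniformly_bifFamily hU ε⟩
  · have hεd : ε ≤ d := hε.2.le.trans (by exact_mod_cast one_le_two.trans hd)
    refine ⟨isNonsingularEndo_bifFamily hε.1 hεd hδ (hU δ hδ), fun hreg => ?_⟩
    have hlift := isC1Lift_bumpLift (d := d) (ε := ε) hδ (hU δ hδ)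
    obtain ⟨κ, p, r, hp, hr, hgap⟩ := exists_isGapLift_bumpLift hd hε hδ (hU δ hδ) hreg
    obtain ⟨p₁, p₂, r₁, r₂, hframe⟩ := hgap.exists_isGapFrame
      (deriv_bumpLift_pos hε.1 hεd hδ (hU δ hδ)) hp (by linarith [hδ.1]) (by linarith [hδ.1]) hr
      fun x hx => (deriv_bumpLift_of_mem_Icc (hU δ hδ) hδ hx).trans_lt hε.2
    exact ⟨isStructurallyStable_of_lift hlift bumpLift_add_one
        hframe.eventually_forall_close_liftConj,
      isHyperbolicAttracting_zero (abs_lt.2 ⟨by linarith [hε.1], hε.2⟩) hδ (hU δ hδ),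
      fun n x hx => hgap.eq_of_isHyperbolicAttracting hlift.2 hx,
      avoidingSet (bifFamily d U ε δ) (openArc p r), hgap.isCantor_avoidingSet hlift.2,
      fun h0 => (disjoint_avoidingSet _ _).le_bot ⟨h0, hgap.coe_mem_openArc⟩,
      hgap.nonWandering_eq hlift.2⟩
  · rw [bifFamily, if_pos ⟨rfl, rfl⟩]
    exact ⟨isNonsingularEndo_linearExpanding (by omega), isStructurallyStable_linearExpanding hd,
      nonWandering_linearExpanding hd⟩
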